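/- **Setting.** Let $(Y_t)_{t\ge 0}$ be a càdlàg process on a probability space, with values in a finite set $\mathcal Y$, and suppose that $Y$ is ergodic in the sense that, for some probability distribution $\pi$ on $\mathcal Y$ and every $y\in\mathcal Y$, $$\frac1t\int_0^t\bigl(1_{\{Y_s=y\}}-\pi(y)\bigr)\,ds\to 0\quad\text{a.s. as } t\to\infty .$$ Let $I\subseteq\mathbb R$ be countable, let $x_0\in I$, and for each $y\in\mathcal Y$ let $q(\cdot,\cdot|y)$ be a conservative intensity matrix on $I$. Assume that there is a finite set $J\subseteq\mathbb R\setminus\{0\}$ with $q(i,i'|y)=0$ for all $y\in\mathcal Y$ and all $i\ne i'$ in $I$ with $i'-i\notin J$, and that $\sup_{i\in I,\,y\in\mathcal Y}\sum_{i'\ne i}q(i,i'|y)<\infty$. For a càdlàg $\mathcal Y$-valued process $Y'$ with jump times $0=\gamma_0<\gamma_1<\gamma_2<\dots$ (with $\gamma_n=\infty$ if there are fewer than $n$ jumps), a *switching process modulated by $Y'$* is a process $X$ on the same probability space that is obtained as follows. Conditionally on the whole process $Y'$, a right-continuous (for the discrete topology on $I$) continuous-time Markov chain $\tilde X^0$ with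 intensity matrix $q(\cdot,\cdot|Y'_0)$ is started in $x_0$. Successively, as long as $\gamma_n<\infty$, conditionally on $Y',\tilde X^0,\dots,\tilde X^{n-1}$, a right-continuous continuous-time Markov chain $\tilde X^{n}$ with intensity matrix $q(\cdot,\cdot|Y'_{\gamma_n})$ is started in $\tilde X^{n-1}_{\gamma_n-\gamma_{n-1}}$. Finally, $X_t=\tilde X^n_{t-\gamma_n}$ for $\gamma_n\le t<\gamma_{n+1}$. For each $\epsilon>0$ let $Y^\epsilon_t=Y_{t/\epsilon}$, and let $X^\epsilon$ be a switching process modulated by $Y^\epsilon$ (with the same $x_0$ and the same $q$ for all $\epsilon$). **Theorem.** Let $Q:I\times\mathcal Y\to\mathbb R$ be such that $\sup_{i\in I,\,|i|\le K}|Q(i,y)|<\infty$ for all $y\in\mathcal Y$ and $K>0$. Then, for all $y\in\mathcal Y$ and $T>0$, the integrals below exist almost surely for each $\epsilon>0$, and $$\sup_{0\le r\le T}\left|\int_0^r Q(X^\epsilon_t,y)\bigl(1_{\{Y^\epsilon_t=y\}}-\pi(y)\bigr)\,dt\right|\to 0\quad\text{in probability as }\epsilon\to0 .$$ -/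

import Mathlib

open MeasureTheory ProbabilityTheory Filter Topology
open scoped NNReal ENNReal

noncomputable section

/-- Right-continuity of a path for the discrete topology on the state space. -/
def IsRightConstant {E : Type*} (f : ℝ≥0 → E) : Prop :=
  ∀ t, ∀ᶠ s in 𝓝[>] t, f s = f t

/-- Càdlàg paths for the discrete topology on the state space. -/
def IsCadlagStep {E : Type*} (f : ℝ≥0 → E) : Prop :=
  IsRightConstant f ∧ ∀ t, ∃ e, ∀ᶠ s in 𝓝[<] t, f s = e

/-- The successive jump times `γ 0 = 0`, `γ (n + 1) = inf {s > γ n | f s ≠ f (γ n)}` of a path.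
The value `⊤` means that there are fewer than `n` jumps. -/
def jumpTime {E : Type*} (f : ℝ≥0 → E) : ℕ → ℝ≥0∞
  | 0 => 0
  | n + 1 => sInf {t : ℝ≥0∞ | ∃ s : ℝ≥0, t = s ∧ jumpTime f n < s ∧
      f s ≠ f (jumpTime f n).toNNReal}

/-- A (conservative) intensity matrix on `E`: nonnegative off-diagonal entries, rows sum to zero. -/
structure IsIntensityMatrix {E : Type*} (G : E → E → ℝ) : Prop where
  nonneg : ∀ i j, i ≠ j → 0 ≤ G i j
  hasSum_zero : ∀ i, HasSum (fun j => G i j) 0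

/-- The total rate `∑_{j ≠ i} G i j` of leaving state `i`. -/
def exitRate {E : Type*} (G : E → E → ℝ) (i : E) : ℝ :=
  ∑' j : {j : E // j ≠ i}, G i j

/-- `P` is a (stochastic) transition function on `E` with intensity matrix `G`: the matrices `P t`
form a semigroup of stochastic matrices whose entrywise derivative at time `0` is `G`. -/
structure IsTransitionFunction {E : Type*} (G : E → E → ℝ) (P : ℝ≥0 → E → E → ℝ) : Prop where
  nonneg : ∀ t i j, 0 ≤ P t i j
  hasSum_one : ∀ t i, HasSum (fun j => P t i j) 1
  zero_self : ∀ i, P 0 i i = 1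
  zero_ne : ∀ i j, i ≠ j → P 0 i j = 0
  semigroup : ∀ s t i j, HasSum (fun k => P s i k * P t k j) (P (s + t) i j)
  deriv_zero : ∀ i j,
    Tendsto (fun h : ℝ≥0 => (P h i j - P 0 i j) / (h : ℝ)) (𝓝[>] 0) (𝓝 (G i j))

/-- The σ-algebra generated by the whole process `Y`, the chains `Z m` with `m < n`, and the chain
`Z n` up to time `s`. -/
abbrev switchingHistory {Ω S E : Type*} [MeasurableSpace S] [MeasurableSpace E]
    (Y : ℝ≥0 → Ω → S) (Z : ℕ → ℝ≥0 → Ω → E) (n : ℕ) (s : ℝ≥0) : MeasurableSpace Ω :=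
  (⨆ t, MeasurableSpace.comap (Y t) inferInstance) ⊔
    (⨆ m, ⨆ _ : m < n, ⨆ t, MeasurableSpace.comap (Z m t) inferInstance) ⊔
    (⨆ u, ⨆ _ : u ≤ s, MeasurableSpace.comap (Z n u) inferInstance)

/-- `X` is a switching process with intensity matrices `q y`, starting state `x₀` and modulating
process `Y` with jump times `γ 0 = 0 < γ 1 < ...`. Conditionally on `Y`, chains `Z 0, Z 1, ...` are
generated successively: `Z n` is a right-continuous continuous-time Markov chain with intensity
matrix `q (Y (γ n))`; `Z 0` starts in `x₀`, and `Z (n + 1)` starts in the state `Z n` has reached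
at time `γ (n + 1)`, that is after running for the time `γ (n + 1) - γ n`. The process `X` follows
`Z n` during `[γ n, γ (n + 1))`. -/
def IsSwitchingProcess {Ω S E : Type*} [MeasurableSpace Ω] [MeasurableSpace S] [MeasurableSpace E]
    (μ : Measure Ω) (q : S → E → E → ℝ) (x₀ : E) (Y : ℝ≥0 → Ω → S) (X : ℝ≥0 → Ω → E) : Prop :=
  let γ : ℕ → Ω → ℝ≥0∞ := fun n ω => jumpTime (fun t => Y t ω) n
  ∃ (P : S → ℝ≥0 → E → E → ℝ) (Z : ℕ → ℝ≥0 → Ω → E),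
    (∀ y, IsTransitionFunction (q y) (P y)) ∧
    (∀ n t, Measurable (Z n t)) ∧
    (∀ n ω, IsRightConstant (fun t => Z n t ω)) ∧
    (∀ ω, Z 0 0 ω = x₀) ∧
    (∀ n ω, γ (n + 1) ω ≠ ⊤ →
      Z (n + 1) 0 ω = Z n (γ (n + 1) ω - γ n ω).toNNReal ω) ∧
    (∀ n s t a, ∀ᵐ ω ∂μ, γ n ω ≠ ⊤ →
      (μ⟦{ω' | Z n (s + t) ω' = a} | switchingHistory Y Z n s⟧) ω =
        P (Y (γ n ω).toNNReal ω) t (Z n s ω) a) ∧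
    (∀ n ω (t : ℝ≥0), γ n ω ≤ t → t < γ (n + 1) ω →
      X t ω = Z n (t - (γ n ω).toNNReal) ω)

end

/-! Put `g = 1_{Y = y} - π y`. The primitive of `g (· / ε)` at `s` is `ε ∫_0^{s/ε} g`, which
ergodicity makes uniformly small on `[0, T]`. By summation by parts, multiplying by a function
bounded by `B` with variation at most `W` enlarges such a primitive by at most the factor `B + W`
(`IsRightConstant.abs_integral_mul_le`). It therefore suffices to control the bound and the
variation of `Q (X ε) y` in probability, uniformly in `ε`.

The rates are at most `C` whatever the modulating process does, so the jumps of `X ε` before `T` are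
dominated by a variable `V` of mean at most `C * T` (`IsSwitchingProcess.exists_jumpCount`). On `V ≤
v` the path stays within distance `M * v` of `x₀`, where `Q` is bounded by some `B`, and the
variation is at most `2 * B * v`; Markov's inequality handles `V ≥ v`.

To count jumps from transition functions alone, each chain is observed on dyadic grids. A step of
length `h` moves with probability at most `C h`, and moves by an amount outside `J` with probability
at most `C² h²`. The second bound is summable over the grids, so almost surely all fine grids show
only steps in `J`; the first, with Fatou's lemma, bounds the mean number of moves. Right-continuity
passes from the grids to the variation of the path. -/

/-! ### Short-time bounds for transition functions. -/

section TransitionFunction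

variable {E : Type*} {G : E → E → ℝ} {P : ℝ≥0 → E → E → ℝ}

theorem IsIntensityMatrix.exitRate_eq (hG : IsIntensityMatrix G) (i : E) :
    exitRate G i = -G i i := by
  classical
  have h := (hG.hasSum_zero i).summable.tsum_subtype_add_tsum_subtype_compl {i}
  rw [(hG.hasSum_zero i).tsum_eq, tsum_singleton (f := fun j => G i j)] at h
  have h2 : exitRate G i = ∑' x : ↑({i}ᶜ : Set E), G i x := rfl
  linarith

theorem IsIntensityMatrix.sum_eq_zero (hG : IsIntensityMatrix G) {i : E} {F : Finset E}
    (hF : ∀ j ∉ F, G i j = 0) : ∑ j ∈ F, G i j = 0 :=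
  (hasSum_sum_of_ne_finset_zero hF).unique (hG.hasSum_zero i)

theorem IsTransitionFunction.sum_le_one (hP : IsTransitionFunction G P) (t : ℝ≥0) (i : E)
    (F : Finset E) : ∑ j ∈ F, P t i j ≤ 1 :=
  sum_le_hasSum F (fun j _ => hP.nonneg t i j) (hP.hasSum_one t i)

theorem IsTransitionFunction.sum_zero (hP : IsTransitionFunction G P) {i : E} {F : Finset E}
    (hi : i ∈ F) : ∑ j ∈ F, P 0 i j = 1 := by
  rw [Finset.sum_eq_single_of_mem i hi fun j _ hj => hP.zero_ne i j hj.symm, hP.zero_self]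

theorem IsTransitionFunction.tendsto_mul_escape (hP : IsTransitionFunction G P) {i : E}
    {F : Finset E} (hi : i ∈ F) (t : ℝ≥0) :
    Tendsto (fun n : ℕ => ((n : ℝ) + 1) * (1 - ∑ j ∈ F, P (t / (n + 1)) i j)) atTop
      (𝓝 (t * -∑ j ∈ F, G i j)) := by
  rcases eq_or_ne t 0 with rfl | ht
  · simp [hP.sum_zero hi]
  have hlim : Tendsto (fun n : ℕ => t / ((n : ℝ≥0) + 1)) atTop (𝓝[>] 0) := by
    refine tendsto_nhdsWithin_iff.2 ⟨?_, Eventually.of_forall fun n => ?_⟩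
    · rw [← NNReal.tendsto_coe]
      push_cast
      simpa [div_eq_mul_inv] using tendsto_one_div_add_atTop_nhds_zero_nat.const_mul (t : ℝ)
    · have : 0 < t := pos_iff_ne_zero.2 ht
      simp only [Set.mem_Ioi]; positivity
  have h := (tendsto_finsetSum F fun j _ => (hP.deriv_zero i j).comp hlim).neg.const_mul (t : ℝ)
  refine h.congr fun n => ?_
  simp only [Function.comp_apply]
  rw [← Finset.sum_div, Finset.sum_sub_distrib, hP.sum_zero hi]
  have : (t : ℝ) ≠ 0 := by exact_mod_cast ht
  push_cast
  field_simp
  ring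

/-- A function which is subadditive up to a quadratic error is at most linear up to the same
error. -/
theorem le_mul_add_of_subadditive {w : ℝ≥0 → ℝ} {K : ℝ} (hK : 0 ≤ K) (h0 : w 0 = 0)
    (hw : ∀ s t, w (s + t) ≤ w s + w t + K * s * t) (h : ℝ≥0) (n : ℕ) :
    w (n * h) ≤ n * w h + K * (n * h) ^ 2 := by
  induction n with
  | zero => simp [h0]
  | succ n ih =>
    have := hw (n * h) h
    have e : ((n + 1 : ℕ) : ℝ≥0) * h = n * h + h := by push_cast; ring
    rw [e]
    push_cast at this ⊢
    have : 0 ≤ K * (n * h * h) := by positivity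
    have : 0 ≤ K * (h * h) := by positivity
    nlinarith

/-- Cutting `[0, t]` into `n + 1` equal pieces and letting `n → ∞` turns the derivative at `0` into
a bound valid for every `t`. -/
theorem IsTransitionFunction.escape_le_of_subadditive (hP : IsTransitionFunction G P) {i : E}
    {F : Finset E} (hi : i ∈ F) {K : ℝ} (hK : 0 ≤ K)
    (hw : ∀ s t, 1 - ∑ j ∈ F, P (s + t) i j ≤
      (1 - ∑ j ∈ F, P s i j) + (1 - ∑ j ∈ F, P t i j) + K * s * t) (t : ℝ≥0) :
    1 - ∑ j ∈ F, P t i j ≤ t * -∑ j ∈ F, G i j + K * t ^ 2 := by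
  refine ge_of_tendsto' ((hP.tendsto_mul_escape hi t).add_const (K * t ^ 2)) fun n => ?_
  have h := le_mul_add_of_subadditive hK (w := fun t => 1 - ∑ j ∈ F, P t i j)
    (by simp [hP.sum_zero hi]) hw (t / (n + 1)) (n + 1)
  have e : ((n + 1 : ℕ) : ℝ≥0) * (t / (n + 1)) = t := by push_cast; field_simp
  have e' : ((n + 1 : ℕ) : ℝ) * ((t / (n + 1) : ℝ≥0) : ℝ) = t := by exact_mod_cast congrArg NNReal.toReal e
  simp only [e, e'] at h
  exact_mod_cast h

theorem IsTransitionFunction.one_sub_le (hP : IsTransitionFunction G P)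
    (hG : IsIntensityMatrix G) (t : ℝ≥0) (i : E) : 1 - P t i i ≤ exitRate G i * t := by
  have h := hP.escape_le_of_subadditive (Finset.mem_singleton_self i) le_rfl (fun s t => ?_) t
  · simp only [Finset.sum_singleton] at h
    rw [hG.exitRate_eq]; linarith
  -- For `F = {i}` there is no quadratic error: being at `i` at both times `s` and `s + t` is one
  -- way to return.
  · have h1 : P s i i * P t i i ≤ P (s + t) i i :=
      le_hasSum (hP.semigroup s t i i) i fun k _ => mul_nonneg (hP.nonneg _ _ _) (hP.nonneg _ _ _)
    have h2 : P s i i ≤ 1 := by simpa using hP.sum_le_one s i {i}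
    have h3 : P t i i ≤ 1 := by simpa using hP.sum_le_one t i {i}
    simp only [Finset.sum_singleton]
    nlinarith [mul_nonneg (sub_nonneg.2 h2) (sub_nonneg.2 h3)]

/-- Leaving `F` takes two jumps. Since `F` carries the whole row `G i`, the linear term of the
escape bound vanishes and only the quadratic error remains. -/
theorem IsTransitionFunction.escape_le_sq (hP : IsTransitionFunction G P)
    (hG : IsIntensityMatrix G) {C : ℝ} (hC0 : 0 ≤ C) (hC : ∀ i, exitRate G i ≤ C)
    {i : E} {F : Finset E} (hi : i ∈ F) (hF : ∀ j ∉ F, G i j = 0) (t : ℝ≥0) :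
    1 - ∑ j ∈ F, P t i j ≤ C ^ 2 * t ^ 2 := by
  classical
  have hst (t : ℝ≥0) (i : E) : 1 - P t i i ≤ C * t :=
    (hP.one_sub_le hG t i).trans (mul_le_mul_of_nonneg_right (hC i) t.2)
  have h := hP.escape_le_of_subadditive hi (sq_nonneg C) (fun s t => ?_) t
  · rw [hG.sum_eq_zero hF] at h; linarith
  have hsplit (u : ℝ≥0) : ∑ j ∈ F, P u i j = P u i i + ∑ j ∈ F.erase i, P u i j :=
    (Finset.add_sum_erase F _ hi).symm
  have hii : P s i i * P t i i ≤ P (s + t) i i :=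
    le_hasSum (hP.semigroup s t i i) i fun k _ => mul_nonneg (hP.nonneg _ _ _) (hP.nonneg _ _ _)
  -- Only two routes to `j` are kept: waiting at `i` until `s`, or being at `j` already at `s` and
  -- again at `s + t`. The loss is `a * C * t` with `a ≤ C * s`.
  have hij : ∑ j ∈ F.erase i, (P s i i * P t i j + P s i j * (1 - C * t)) ≤
      ∑ j ∈ F.erase i, P (s + t) i j := by
    refine Finset.sum_le_sum fun j hj => ?_
    have h1 := sum_le_hasSum {i, j}
      (fun k _ => mul_nonneg (hP.nonneg s i k) (hP.nonneg t k j)) (hP.semigroup s t i j)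
    rw [Finset.sum_pair (Finset.ne_of_mem_erase hj).symm] at h1
    have := mul_le_mul_of_nonneg_left (hst t j) (hP.nonneg s i j)
    linarith
  rw [Finset.sum_add_distrib, ← Finset.mul_sum, ← Finset.sum_mul] at hij
  set a := ∑ j ∈ F.erase i, P s i j
  have ha : P s i i + a ≤ 1 := by rw [← hsplit s]; exact hP.sum_le_one s i F
  have ha' : a ≤ C * s := by linarith [hst s i]
  have hw : ∑ j ∈ F, P t i j ≤ 1 := hP.sum_le_one t i F
  have hs1 : P s i i ≤ 1 := by simpa using hP.sum_le_one s i {i}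
  have h4 := mul_le_mul_of_nonneg_right ha' (mul_nonneg hC0 t.2)
  have h5 := mul_nonneg (sub_nonneg.2 hs1) (sub_nonneg.2 hw)
  simp only [hsplit] at hw h5 ⊢
  have e : C ^ 2 * s * t = C * s * (C * t) := by ring
  have h6 : (0:ℝ) ≤ t := t.2
  rw [e]
  change a * (C * t) ≤ C * s * (C * t) at h4
  nlinarith

end TransitionFunction

/-! ### Dyadic approximation from the right and measurability. -/

section RightConstant

/-- The smallest multiple of `2⁻ᵐ` that is larger than `t`. -/
noncomputable def roundUp (m : ℕ) (t : ℝ≥0) : ℝ≥0 := ((⌊t * 2 ^ m⌋₊ + 1 : ℕ) : ℝ≥0) / 2 ^ m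

theorem lt_roundUp (m : ℕ) (t : ℝ≥0) : t < roundUp m t := by
  rw [roundUp, lt_div_iff₀ (by positivity)]
  exact_mod_cast Nat.lt_floor_add_one (t * 2 ^ m)

theorem roundUp_le (m : ℕ) (t : ℝ≥0) : roundUp m t ≤ t + 1 / 2 ^ m := by
  rw [roundUp, div_le_iff₀ (by positivity), add_mul, one_div,
    inv_mul_cancel₀ (by positivity : (2 : ℝ≥0) ^ m ≠ 0)]
  push_cast
  gcongr
  exact Nat.floor_le zero_le

theorem tendsto_roundUp (t : ℝ≥0) : Tendsto (fun m => roundUp m t) atTop (𝓝[>] t) := by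
  refine tendsto_nhdsWithin_iff.2 ⟨?_, Eventually.of_forall fun m => lt_roundUp m t⟩
  refine tendsto_of_tendsto_of_tendsto_of_le_of_le tendsto_const_nhds ?_
    (fun m => (lt_roundUp m t).le) (fun m => roundUp_le m t)
  have h : Tendsto (fun m : ℕ => (1 / 2 : ℝ≥0) ^ m) atTop (𝓝 0) :=
    NNReal.tendsto_pow_atTop_nhds_zero_of_lt_one (by norm_num)
  simpa [one_div, inv_pow] using h.const_add t

theorem IsRightConstant.eventually_roundUp {E : Type*} {f : ℝ≥0 → E} (hf : IsRightConstant f)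
    (t : ℝ≥0) : ∀ᶠ m in atTop, f (roundUp m t) = f t :=
  (tendsto_roundUp t).eventually (hf t)

theorem IsRightConstant.comp {E F : Type*} {f : ℝ≥0 → E} (hf : IsRightConstant f) (g : E → F) :
    IsRightConstant (fun t => g (f t)) :=
  fun t => (hf t).mono fun _ h => congrArg g h

/-- A process with right-constant paths in a countable space is jointly measurable. -/
theorem measurable_uncurry_of_isRightConstant {Ω E : Type*} {m0 : MeasurableSpace Ω}
    [Countable E] [MeasurableSpace E] [MeasurableSingletonClass E] {Y : ℝ≥0 → Ω → E}
    (hY : ∀ t, Measurable (Y t)) (hr : ∀ ω, IsRightConstant (fun t => Y t ω)) :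
    Measurable (fun p : ℝ≥0 × Ω => Y p.1 p.2) := by
  refine measurable_to_countable' fun y => ?_
  have hm (m : ℕ) : Measurable (fun p : ℝ≥0 × Ω => Y (roundUp m p.1) p.2) := by
    have h1 : Measurable (fun p : ℕ × Ω => Y (((p.1 + 1 : ℕ) : ℝ≥0) / 2 ^ m) p.2) :=
      measurable_from_prod_countable_right fun k => hY (((k + 1 : ℕ) : ℝ≥0) / 2 ^ m)
    have h2 : Measurable (fun p : ℝ≥0 × Ω => (⌊p.1 * 2 ^ m⌋₊, p.2)) :=
      (Nat.measurable_floor.comp (measurable_fst.mul_const _)).prodMk measurable_snd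
    exact h1.comp h2
  have e : (fun p : ℝ≥0 × Ω => Y p.1 p.2) ⁻¹' {y} =
      ⋃ N, ⋂ m, ⋂ _ : N ≤ m, (fun p : ℝ≥0 × Ω => Y (roundUp m p.1) p.2) ⁻¹' {y} := by
    ext p
    have hev := (hr p.2).eventually_roundUp p.1
    simp only [Set.mem_preimage, Set.mem_singleton_iff, Set.mem_iUnion, Set.mem_iInter]
    constructor
    · rintro rfl
      exact eventually_atTop.1 hev
    · rintro ⟨N, hN⟩
      obtain ⟨m, h1, h2⟩ := (hev.and (eventually_ge_atTop N)).exists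
      rw [← h1, hN m h2]
  rw [e]
  exact .iUnion fun N => .iInter fun m => .iInter fun _ => hm m (measurableSet_singleton y)

theorem IsRightConstant.measurable {E : Type*} [Countable E] [MeasurableSpace E]
    [MeasurableSingletonClass E] {f : ℝ≥0 → E} (hf : IsRightConstant f) : Measurable f :=
  (measurable_uncurry_of_isRightConstant (Ω := Unit) (m0 := ⊤) (Y := fun t _ => f t)
    (fun _ => measurable_const) (fun _ => hf)).comp (measurable_id.prodMk (measurable_const (a := ())))

theorem IsCadlagStep.comp_div {E : Type*} {f : ℝ≥0 → E} (hf : IsCadlagStep f) {ε : ℝ≥0}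
    (hε : 0 < ε) : IsCadlagStep (fun t => f (t / ε)) := by
  have hc (t : ℝ≥0) : Tendsto (fun s => s / ε) (𝓝 t) (𝓝 (t / ε)) :=
    (continuous_id.div_const ε).tendsto t
  refine ⟨fun t => ?_, fun t => ?_⟩
  · refine (tendsto_nhdsWithin_iff.2 ⟨(hc t).mono_left nhdsWithin_le_nhds, ?_⟩).eventually
      (hf.1 (t / ε))
    filter_upwards [self_mem_nhdsWithin] with s hs
    exact div_lt_div_of_pos_right hs hε
  · obtain ⟨e, he⟩ := hf.2 (t / ε)
    refine ⟨e, (tendsto_nhdsWithin_iff.2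
      ⟨(hc t).mono_left nhdsWithin_le_nhds, ?_⟩).eventually he⟩
    filter_upwards [self_mem_nhdsWithin] with s hs
    exact div_lt_div_of_pos_right hs hε

end RightConstant

/-! ### Variation of a path read off from dyadic grids. -/

section GridSum

variable {E : Type*}

open Classical in
/-- The cost `c` of the steps of a path along the multiples of `2⁻ᵐ`, for the steps that start
in `[0, ℓ]`. -/
noncomputable def gridSum (c : E → E → ℝ≥0∞) (z : ℝ≥0 → E) (ℓ : ℝ≥0) (m : ℕ) : ℝ≥0∞ :=
  ∑' k : ℕ, if (k : ℝ≥0) / 2 ^ m ≤ ℓ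
    then c (z ((k : ℝ≥0) / 2 ^ m)) (z (((k + 1 : ℕ) : ℝ≥0) / 2 ^ m)) else 0

theorem sum_edist_le_sum_Ico {α : Type*} [PseudoEMetricSpace α] (g : ℕ → α) {K : ℕ → ℕ}
    (hK : Monotone K) (n : ℕ) :
    ∑ i ∈ Finset.range n, edist (g (K (i + 1))) (g (K i)) ≤
      ∑ k ∈ Finset.Ico (K 0) (K n), edist (g k) (g (k + 1)) := by
  induction n with
  | zero => simp
  | succ n ih =>
    rw [Finset.sum_range_succ, ← Finset.sum_Ico_consecutive _ (hK n.zero_le) (hK n.le_succ),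
      edist_comm]
    exact add_le_add ih (edist_le_Ico_sum_edist g (hK n.le_succ))

/-- A partition has finitely many points, and on fine grids each can be rounded up without changing
the value of `f`; the triangle inequality then compares with the grid. -/
theorem IsRightConstant.eVariationOn_le_of_frequently {F : Type*} [PseudoEMetricSpace F]
    {f : ℝ≥0 → F} (hf : IsRightConstant f) (ℓ : ℝ≥0) {V : ℝ≥0∞}
    (hV : ∃ᶠ m in atTop, gridSum edist f ℓ m ≤ V) :
    eVariationOn f (Set.Icc 0 ℓ) ≤ V := by
  refine iSup_le ?_
  rintro ⟨n, u, hu, hmem⟩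
  have hev : ∀ᶠ m in atTop, ∀ i ∈ Finset.range (n + 1), f (roundUp m (u i)) = f (u i) :=
    (Finset.eventually_all _).2 fun i _ => hf.eventually_roundUp (u i)
  obtain ⟨m, hm, hmV⟩ := (hev.and_frequently hV).exists
  refine le_trans ?_ hmV
  let K : ℕ → ℕ := fun i => ⌊u i * 2 ^ m⌋₊ + 1
  have hK : Monotone K := fun i j hij => by
    simp only [K]
    have := hu hij
    gcongr
  have h1 : ∑ i ∈ Finset.range n, edist (f (u (i + 1))) (f (u i)) =
      ∑ i ∈ Finset.range n, edist (f ((K (i + 1) : ℝ≥0) / 2 ^ m)) (f ((K i : ℝ≥0) / 2 ^ m)) := by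
    refine Finset.sum_congr rfl fun i hi => ?_
    have hi' := Finset.mem_range.1 hi
    rw [← hm i (Finset.mem_range.2 (by omega)), ← hm (i + 1) (Finset.mem_range.2 (by omega))]
    rfl
  rw [h1]
  refine (sum_edist_le_sum_Ico (fun k : ℕ => f ((k : ℝ≥0) / 2 ^ m)) hK n).trans ?_
  rw [gridSum]
  refine le_trans (Finset.sum_le_sum fun k hk => ?_) (ENNReal.sum_le_tsum _)
  -- Rounding up may overshoot `ℓ`, but the last step used still starts in `[0, ℓ]`; hence the
  -- convention in `gridSum`.
  have hk2 : k < ⌊u n * 2 ^ m⌋₊ + 1 := (Finset.mem_Ico.1 hk).2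
  have hk3 : (k : ℝ≥0) / 2 ^ m ≤ ℓ := by
    rw [div_le_iff₀ (by positivity)]
    calc (k : ℝ≥0) ≤ ⌊u n * 2 ^ m⌋₊ := by exact_mod_cast Nat.lt_succ_iff.1 hk2
      _ ≤ u n * 2 ^ m := Nat.floor_le zero_le
      _ ≤ ℓ * 2 ^ m := by gcongr; exact (hmem n).2
  rw [if_pos hk3]

open Classical in
/-- The grid sum which counts the steps that do not lead from `i` into `F i`. -/
noncomputable abbrev gridEscapes (F : E → Finset E) : (ℝ≥0 → E) → ℝ≥0 → ℕ → ℝ≥0∞ :=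
  gridSum fun i j => if j ∈ F i then 0 else 1

/-- Once every grid step leads into `F`, a step costs at most `c` if it moves and nothing otherwise.
The lower limit is the form that Fatou's lemma needs. -/
theorem IsRightConstant.eVariationOn_le_liminf {z : ℝ≥0 → E} (hz : IsRightConstant z) (ℓ : ℝ≥0)
    {F : E → Finset E} (hF : ∀ᶠ m in atTop, gridEscapes F z ℓ m = 0) {φ : E → ℝ} {c : ℝ≥0}
    (hφ : ∀ i, ∀ j ∈ F i, |φ i - φ j| ≤ c) :
    eVariationOn (fun t => φ (z t)) (Set.Icc 0 ℓ) ≤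
      c * liminf (fun m => gridEscapes (fun i => {i}) z ℓ m) atTop := by
  classical
  have key : ∀ᶠ m in atTop, gridSum edist (fun t => φ (z t)) ℓ m ≤
      c * gridEscapes (fun i => {i}) z ℓ m := by
    filter_upwards [hF] with m hm
    rw [gridEscapes, gridSum, gridSum, ← ENNReal.tsum_mul_left]
    rw [gridEscapes, gridSum, ENNReal.tsum_eq_zero] at hm
    refine ENNReal.tsum_le_tsum fun k => ?_
    have hk := hm k
    by_cases h1 : (k : ℝ≥0) / 2 ^ m ≤ ℓ
    · rw [if_pos h1] at hk ⊢
      rw [if_pos h1]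
      set a := z ((k : ℝ≥0) / 2 ^ m)
      set b := z (((k + 1 : ℕ) : ℝ≥0) / 2 ^ m)
      have h2 : b ∈ F a := by
        by_contra h
        simp [h] at hk
      by_cases h3 : b ∈ ({a} : Finset E)
      · rw [Finset.mem_singleton.1 h3]; simp
      · rw [if_neg h3, edist_dist, Real.dist_eq, mul_one]
        exact ENNReal.ofReal_le_of_le_toReal (by simpa using hφ _ _ h2)
    · simp [h1]
  rw [← ENNReal.liminf_const_mul_of_ne_top ENNReal.coe_ne_top]
  refine le_trans ?_ (liminf_le_liminf key)
  refine le_of_forall_gt fun V hV => ?_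
  obtain ⟨V', h1, h2⟩ := exists_between hV
  exact (hz.comp φ).eVariationOn_le_of_frequently ℓ
    ((frequently_lt_of_liminf_lt (by isBoundedDefault) h1).mono fun _ h => h.le) |>.trans_lt h2

theorem tsum_grid_le (ℓ : ℝ≥0) (m : ℕ) :
    ∑' k : ℕ, (if (k : ℝ≥0) / 2 ^ m ≤ ℓ then (1 / 2 ^ m : ℝ≥0∞) else 0) ≤ ℓ + 1 / 2 ^ m := by
  have h : ∀ k ∉ Finset.range (⌊ℓ * 2 ^ m⌋₊ + 1),
      (if (k : ℝ≥0) / 2 ^ m ≤ ℓ then (1 / 2 ^ m : ℝ≥0∞) else 0) = 0 := by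
    intro k hk
    rw [if_neg]
    rw [div_le_iff₀ (by positivity)]
    intro h
    exact hk (Finset.mem_range.2 (Nat.lt_succ_of_le (Nat.le_floor h)))
  rw [tsum_eq_sum h]
  calc _ ≤ ∑ k ∈ Finset.range (⌊ℓ * 2 ^ m⌋₊ + 1), (1 / 2 ^ m : ℝ≥0∞) :=
        Finset.sum_le_sum fun k _ => by split_ifs <;> simp
    _ = ((roundUp m ℓ : ℝ≥0) : ℝ≥0∞) := by
        rw [Finset.sum_const, Finset.card_range, nsmul_eq_mul, roundUp, ENNReal.coe_div (by simp)]
        push_cast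
        rw [mul_one_div]
    _ ≤ ((ℓ + 1 / 2 ^ m : ℝ≥0) : ℝ≥0∞) := ENNReal.coe_le_coe.2 (roundUp_le m ℓ)
    _ = _ := by
        rw [ENNReal.coe_add, ENNReal.coe_div (by simp)]; push_cast; rfl

theorem gridEscapes_eq_zero_of_lt_one {F : E → Finset E} {z : ℝ≥0 → E} {ℓ : ℝ≥0} {m : ℕ}
    (h : gridEscapes F z ℓ m < 1) : gridEscapes F z ℓ m = 0 := by
  classical
  rw [gridEscapes, gridSum, ENNReal.tsum_eq_zero]
  intro k
  have hk := (ENNReal.le_tsum k).trans_lt h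
  split_ifs at hk ⊢ <;> simp_all

end GridSum

/-! ### Expected number of escapes along one grid. -/

section Markov

variable {Ω E : Type*} {m1 m0 : MeasurableSpace Ω} {μ : Measure Ω}
  [Countable E] [MeasurableSpace E] [MeasurableSingletonClass E]

/-- If the conditional law of `V` gives mass at least `1 - κ` to the set `F U`, then `V` leaves
`F U` with probability at most `κ` on every event of the past. -/
theorem measure_inter_notMem_le [IsProbabilityMeasure μ] (hm1 : m1 ≤ m0) {U V : Ω → E}
    (hU : Measurable[m1] U) (hV : Measurable V) {D A : Set Ω} {p : Ω → E → E → ℝ}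
    (hp : ∀ a, ∀ᵐ ω ∂μ, ω ∈ D → (μ⟦{ω' | V ω' = a} | m1⟧) ω = p ω (U ω) a)
    {F : E → Finset E} {κ : ℝ≥0} (hκ : ∀ ω i, 1 - ∑ j ∈ F i, p ω i j ≤ κ)
    (hA : MeasurableSet[m1] A) (hAD : A ⊆ D) :
    μ (A ∩ {ω | V ω ∉ F (U ω)}) ≤ κ * μ A := by
  classical
  have hVa (a : E) : MeasurableSet {ω | V ω = a} := hV (measurableSet_singleton a)
  have hAi (i : E) : MeasurableSet[m1] (A ∩ {ω | U ω = i}) :=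
    hA.inter (hU (measurableSet_singleton i))
  have hVF (i : E) : MeasurableSet {ω | V ω ∈ F i} := hV (F i).measurableSet
  -- On `{U = i}`, an event of the past, the target `F i` is a fixed finite set, so the conditional
  -- probabilities can be summed.
  have hreal (i : E) : μ.real (A ∩ {ω | U ω = i} ∩ {ω | V ω ∈ F i}) ≥
      (1 - κ) * μ.real (A ∩ {ω | U ω = i}) := by
    have h1 : A ∩ {ω | U ω = i} ∩ {ω | V ω ∈ F i} =
        ⋃ a ∈ F i, A ∩ {ω | U ω = i} ∩ {ω | V ω = a} := by
      ext ω; simp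
    have h2 : μ.real (A ∩ {ω | U ω = i} ∩ {ω | V ω ∈ F i}) =
        ∫ ω in A ∩ {ω | U ω = i}, ∑ a ∈ F i, (μ⟦{ω' | V ω' = a} | m1⟧) ω ∂μ := by
      rw [h1, measureReal_biUnion_finset, integral_finsetSum]
      · refine Finset.sum_congr rfl fun a _ => ?_
        rw [setIntegral_condExp hm1 ((integrable_const _).indicator (hVa a)) (hAi i),
          setIntegral_indicator (hVa a)]
        simp
      · exact fun a _ => integrable_condExp.integrableOn
      · intro a _ b _ hab
        refine Set.disjoint_left.2 fun ω h1 h2 => hab ?_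
        rw [← h1.2, ← h2.2]
      · exact fun a _ => (hm1 _ (hAi i)).inter (hVa a)
    rw [h2, ge_iff_le, mul_comm, ← smul_eq_mul, ← setIntegral_const]
    refine setIntegral_mono_on_ae (integrable_const _).integrableOn
      (integrable_finsetSum _ fun a _ => integrable_condExp.integrableOn) (hm1 _ (hAi i)) ?_
    have hall : ∀ᵐ ω ∂μ, ∀ a, ω ∈ D → (μ⟦{ω' | V ω' = a} | m1⟧) ω = p ω (U ω) a :=
      ae_all_iff.2 hp
    filter_upwards [hall] with ω hω hωA
    rw [Finset.sum_congr rfl fun a _ => hω a (hAD hωA.1), show U ω = i from hωA.2]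
    linarith [hκ ω i]
  have hi (i : E) : μ (A ∩ {ω | U ω = i} ∩ {ω | V ω ∉ F i}) ≤ κ * μ (A ∩ {ω | U ω = i}) := by
    have h3 := measureReal_inter_add_sdiff (μ := μ) (s := A ∩ {ω | U ω = i}) (hVF i)
    have h4 : A ∩ {ω | U ω = i} ∩ {ω | V ω ∉ F i} = (A ∩ {ω | U ω = i}) \ {ω | V ω ∈ F i} := rfl
    have h5 : μ.real (A ∩ {ω | U ω = i} ∩ {ω | V ω ∉ F i}) ≤
        κ * μ.real (A ∩ {ω | U ω = i}) := by
      rw [h4]; linarith [hreal i]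
    rw [← ENNReal.toReal_le_toReal (measure_ne_top _ _)
      (ENNReal.mul_ne_top ENNReal.coe_ne_top (measure_ne_top _ _)), ENNReal.toReal_mul]
    exact h5
  calc μ (A ∩ {ω | V ω ∉ F (U ω)})
      ≤ μ (⋃ i, A ∩ {ω | U ω = i} ∩ {ω | V ω ∉ F i}) := by
        refine measure_mono fun ω hω => Set.mem_iUnion.2 ⟨U ω, ⟨hω.1, rfl⟩, hω.2⟩
    _ ≤ ∑' i, μ (A ∩ {ω | U ω = i} ∩ {ω | V ω ∉ F i}) := measure_iUnion_le _
    _ ≤ ∑' i, κ * μ (A ∩ {ω | U ω = i}) := ENNReal.tsum_le_tsum hi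
    _ = κ * μ A := by
        rw [ENNReal.tsum_mul_left, ← measure_iUnion _ fun i => hm1 _ (hAi i)]
        · congr 2
          ext ω; simp
        · intro i j hij
          refine Set.disjoint_left.2 fun ω h1 h2 => hij ?_
          rw [← h1.2, ← h2.2]

theorem measurable_gridEscapes {Z : ℝ≥0 → Ω → E} (hZ : ∀ t, Measurable (Z t)) {ℓ : Ω → ℝ≥0}
    (hℓ : Measurable ℓ) (F : E → Finset E) (m : ℕ) :
    Measurable fun ω => gridEscapes F (fun t => Z t ω) (ℓ ω) m := by
  classical
  refine Measurable.tsum fun k => ?_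
  refine Measurable.ite (hℓ measurableSet_Ici) ?_ measurable_const
  exact (Measurable.of_discrete (α := E × E) (f := fun p => if p.2 ∈ F p.1 then (0 : ℝ≥0∞) else 1)).comp
    ((hZ _).prodMk (hZ _))

/-- The expected number of escapes along a grid up to a random time. -/
theorem setLIntegral_gridEscapes_le (hm1 : m1 ≤ m0) {Z : ℝ≥0 → Ω → E}
    (hZ : ∀ t, Measurable (Z t)) {D : Set Ω} (hD : MeasurableSet[m1] D) {ℓ : Ω → ℝ≥0}
    (hℓ : Measurable[m1] ℓ) {F : E → Finset E} {m : ℕ} {κ : ℝ≥0}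
    (h : ∀ (k : ℕ) A, MeasurableSet[m1] A → A ⊆ D →
      μ (A ∩ {ω | Z (((k + 1 : ℕ) : ℝ≥0) / 2 ^ m) ω ∉ F (Z ((k : ℝ≥0) / 2 ^ m) ω)}) ≤
        κ * (1 / 2 ^ m) * μ A) :
    ∫⁻ ω in D, gridEscapes F (fun t => Z t ω) (ℓ ω) m ∂μ ≤
      κ * ∫⁻ ω in D, (ℓ ω + 1 / 2 ^ m) ∂μ := by
  classical
  have hℓ0 : Measurable ℓ := hℓ.mono hm1 le_rfl
  have hm : ∀ k : ℕ, Measurable fun ω => if (k : ℝ≥0) / 2 ^ m ≤ ℓ ω then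
      (if Z (((k + 1 : ℕ) : ℝ≥0) / 2 ^ m) ω ∈ F (Z ((k : ℝ≥0) / 2 ^ m) ω) then (0 : ℝ≥0∞) else 1)
      else 0 := by
    intro k
    refine Measurable.ite (hℓ0 measurableSet_Ici) ?_ measurable_const
    exact (Measurable.of_discrete (α := E × E)
      (f := fun p => if p.2 ∈ F p.1 then (0 : ℝ≥0∞) else 1)).comp ((hZ _).prodMk (hZ _))
  simp only [gridEscapes, gridSum]
  rw [lintegral_tsum fun k => (hm k).aemeasurable]
  calc _ ≤ ∑' k : ℕ, κ * ∫⁻ ω in D, (if (k : ℝ≥0) / 2 ^ m ≤ ℓ ω then (1 / 2 ^ m : ℝ≥0∞) else 0) ∂μ := by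
        refine ENNReal.tsum_le_tsum fun k => ?_
        have hS : MeasurableSet[m1] {ω | (k : ℝ≥0) / 2 ^ m ≤ ℓ ω} := hℓ measurableSet_Ici
        have hN : MeasurableSet {ω | Z (((k + 1 : ℕ) : ℝ≥0) / 2 ^ m) ω ∉
            F (Z ((k : ℝ≥0) / 2 ^ m) ω)} :=
          ((hZ _).prodMk (hZ _)) (MeasurableSet.of_discrete (α := E × E) (s := {p | p.1 ∉ F p.2}))
        -- The horizon `ℓ` is `m1`-measurable, so whether the `k`-th step counts is part of the
        -- conditioning event.
        have h1 := h k (D ∩ {ω | (k : ℝ≥0) / 2 ^ m ≤ ℓ ω}) (hD.inter hS) Set.inter_subset_left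
        have e1 : (fun ω => if (k : ℝ≥0) / 2 ^ m ≤ ℓ ω then (1 / 2 ^ m : ℝ≥0∞) else 0) =
            {ω | (k : ℝ≥0) / 2 ^ m ≤ ℓ ω}.indicator fun _ => (1 / 2 ^ m : ℝ≥0∞) := by
          ext ω; simp [Set.indicator_apply]
        have e2 : (fun ω => if (k : ℝ≥0) / 2 ^ m ≤ ℓ ω then
            (if Z (((k + 1 : ℕ) : ℝ≥0) / 2 ^ m) ω ∈ F (Z ((k : ℝ≥0) / 2 ^ m) ω)
              then (0 : ℝ≥0∞) else 1) else 0) =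
            ({ω | (k : ℝ≥0) / 2 ^ m ≤ ℓ ω} ∩ {ω | Z (((k + 1 : ℕ) : ℝ≥0) / 2 ^ m) ω ∉
              F (Z ((k : ℝ≥0) / 2 ^ m) ω)}).indicator fun _ => (1 : ℝ≥0∞) := by
          ext ω
          simp only [Set.indicator_apply, Set.mem_inter_iff, Set.mem_ofPred_eq]
          split_ifs <;> simp_all
        rw [e1, e2, lintegral_indicator_const (hm1 _ hS),
          lintegral_indicator_const ((hm1 _ hS).inter hN), Measure.restrict_apply (hm1 _ hS),
          Measure.restrict_apply ((hm1 _ hS).inter hN), one_mul, ← mul_assoc]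
        convert h1 using 2
        · ext ω; simp only [Set.mem_inter_iff]; tauto
        · rw [Set.inter_comm]
    _ = κ * ∫⁻ ω in D, ∑' k : ℕ, (if (k : ℝ≥0) / 2 ^ m ≤ ℓ ω then (1 / 2 ^ m : ℝ≥0∞) else 0) ∂μ := by
        rw [ENNReal.tsum_mul_left, lintegral_tsum]
        exact fun k => (Measurable.ite (hℓ0 measurableSet_Ici) measurable_const
          measurable_const).aemeasurable
    _ ≤ _ := by gcongr with ω; exact tsum_grid_le (ℓ ω) m

end Markov

/-! ### Jump times: no accumulation, measurability. -/

section JumpTime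

variable {S : Type*} {f : ℝ≥0 → S}

theorem jumpTime_le_succ (f : ℝ≥0 → S) (n : ℕ) : jumpTime f n ≤ jumpTime f (n + 1) := by
  rw [jumpTime]
  refine le_sInf ?_
  rintro _ ⟨s, rfl, h, -⟩
  exact h.le

theorem jumpTime_mono (f : ℝ≥0 → S) : Monotone (jumpTime f) :=
  monotone_nat_of_le_succ (jumpTime_le_succ f)

theorem IsRightConstant.jumpTime_lt_succ (hf : IsRightConstant f) {n : ℕ}
    (h : jumpTime f n ≠ ⊤) : jumpTime f n < jumpTime f (n + 1) := by
  obtain ⟨b, hb, hb'⟩ := mem_nhdsGT_iff_exists_Ioo_subset.1 (hf (jumpTime f n).toNNReal)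
  calc jumpTime f n = ((jumpTime f n).toNNReal : ℝ≥0∞) := (ENNReal.coe_toNNReal h).symm
    _ < b := ENNReal.coe_lt_coe.2 hb
    _ ≤ jumpTime f (n + 1) := by
      rw [jumpTime]
      refine le_sInf ?_
      rintro _ ⟨s, rfl, h1, h2⟩
      rw [← ENNReal.coe_toNNReal h, ENNReal.coe_lt_coe] at h1
      by_contra hlt
      exact h2 (hb' ⟨h1, ENNReal.coe_lt_coe.1 (not_le.1 hlt)⟩)

/-- Bounded jump times would increase strictly to a limit, and the left limit there makes `f`
constant just before it, leaving no room for another jump. -/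
theorem IsCadlagStep.exists_lt_jumpTime (hf : IsCadlagStep f) (T : ℝ≥0) :
    ∃ n, (T : ℝ≥0∞) < jumpTime f n := by
  by_contra! hcon
  have htop (n : ℕ) : jumpTime f n ≠ ⊤ := ((hcon n).trans_lt ENNReal.coe_lt_top).ne
  let g : ℕ → ℝ≥0 := fun n => (jumpTime f n).toNNReal
  have hg (n : ℕ) : (g n : ℝ≥0∞) = jumpTime f n := ENNReal.coe_toNNReal (htop n)
  have hmono : StrictMono g := strictMono_nat_of_lt_succ fun n => by
    rw [← ENNReal.coe_lt_coe, hg, hg]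
    exact hf.1.jumpTime_lt_succ (htop n)
  have hbdd : BddAbove (Set.range g) := by
    refine ⟨T, ?_⟩
    rintro _ ⟨n, rfl⟩
    rw [← ENNReal.coe_le_coe, hg]
    exact hcon n
  have hlt (n : ℕ) : g n < ⨆ n, g n := (hmono n.lt_succ_self).trans_le (le_ciSup hbdd _)
  obtain ⟨e, he⟩ := hf.2 (⨆ n, g n)
  obtain ⟨b, hb, hb'⟩ := (mem_nhdsLT_iff_exists_Ioo_subset' (hlt 0)).1 he
  obtain ⟨N, hN⟩ := exists_lt_of_lt_ciSup (show b < ⨆ n, g n from hb)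
  have h1 : jumpTime f (N + 1) < ((⨆ n, g n : ℝ≥0) : ℝ≥0∞) := by
    rw [← hg, ENNReal.coe_lt_coe]
    exact hlt _
  rw [jumpTime, sInf_lt_iff] at h1
  obtain ⟨_, ⟨s, rfl, h2, h3⟩, h4⟩ := h1
  rw [← hg, ENNReal.coe_lt_coe] at h2
  refine h3 ?_
  have h5 : f s = e := hb' ⟨hN.trans h2, ENNReal.coe_lt_coe.1 h4⟩
  have h6 : f (g N) = e := hb' ⟨hN, hlt N⟩
  rw [h5, ← h6]

/-- The jump index at a given time. -/
theorem IsCadlagStep.exists_mem_Ico_jumpTime (hf : IsCadlagStep f) (t : ℝ≥0) :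
    ∃ n, jumpTime f n ≤ t ∧ (t : ℝ≥0∞) < jumpTime f (n + 1) := by
  classical
  have h := hf.exists_lt_jumpTime t
  rcases hn : Nat.find h with _ | n
  · have := Nat.find_spec h
    rw [hn, jumpTime] at this
    exact absurd this not_lt_zero
  · refine ⟨n, not_lt.1 (Nat.find_min h (hn ▸ n.lt_succ_self)), ?_⟩
    have := Nat.find_spec h
    rwa [hn] at this

variable {Ω : Type*} {m0 : MeasurableSpace Ω} [Countable S] [MeasurableSpace S]
  [MeasurableSingletonClass S] {Y : ℝ≥0 → Ω → S}

theorem measurable_jumpTime (hY : ∀ t, Measurable (Y t))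
    (hr : ∀ ω, IsRightConstant (fun t => Y t ω)) (n : ℕ) :
    Measurable fun ω => jumpTime (fun t => Y t ω) n := by
  induction n with
  | zero => exact measurable_const
  | succ n ih =>
    have hpost : Measurable fun ω => Y (jumpTime (fun t => Y t ω) n).toNNReal ω :=
      (measurable_uncurry_of_isRightConstant hY hr).comp (ih.ennreal_toNNReal.prodMk measurable_id)
    refine measurable_of_Iio fun t => ?_
    -- A change of value seen at `s < t` is still seen at a dyadic point slightly to the right of
    -- `s`, so countably many times suffice.
    have e : (fun ω => jumpTime (fun t => Y t ω) (n + 1)) ⁻¹' Set.Iio t =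
        ⋃ m : ℕ, ⋃ k : ℕ, {ω | ((((k + 1 : ℕ) : ℝ≥0) / 2 ^ m : ℝ≥0) : ℝ≥0∞) < t} ∩
          {ω | jumpTime (fun t => Y t ω) n < (((k + 1 : ℕ) : ℝ≥0) / 2 ^ m : ℝ≥0)} ∩
          {ω | Y (((k + 1 : ℕ) : ℝ≥0) / 2 ^ m) ω ≠ Y (jumpTime (fun t => Y t ω) n).toNNReal ω} := by
      ext ω
      simp only [Set.mem_preimage, Set.mem_Iio, Set.mem_iUnion]
      rw [jumpTime, sInf_lt_iff]
      constructor
      · rintro ⟨_, ⟨s, rfl, h1, h2⟩, h3⟩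
        have h4 : ∀ᶠ m in atTop, ((roundUp m s : ℝ≥0) : ℝ≥0∞) < t :=
          ((ENNReal.continuous_coe.tendsto s).comp ((tendsto_roundUp s).mono_right
            nhdsWithin_le_nhds)).eventually_lt_const h3
        obtain ⟨m, h5, h6⟩ := (h4.and ((hr ω).eventually_roundUp s)).exists
        refine ⟨m, ⌊s * 2 ^ m⌋₊, ⟨h5, h1.trans (ENNReal.coe_lt_coe.2 (lt_roundUp m s))⟩, ?_⟩
        exact fun h => h2 (h6.symm.trans h)
      · rintro ⟨m, k, ⟨h1, h2⟩, h3⟩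
        exact ⟨_, ⟨_, rfl, h2, h3⟩, h1⟩
    rw [e]
    refine .iUnion fun m => .iUnion fun k => ((MeasurableSet.const _).inter ?_).inter ?_
    · exact ih measurableSet_Iio
    · exact (measurableSet_eq_fun (hY _) hpost).compl

end JumpTime

/-! ### Refining the grids for a single chain. -/

section Chain

variable {Ω E : Type*} {m1 m0 : MeasurableSpace Ω} {μ : Measure Ω}
  [Countable E] [MeasurableSpace E] [MeasurableSingletonClass E]

theorem setLIntegral_liminf_gridEscapes_le [IsFiniteMeasure μ] (hm1 : m1 ≤ m0) {Z : ℝ≥0 → Ω → E}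
    (hZ : ∀ t, Measurable (Z t)) {D : Set Ω} (hD : MeasurableSet[m1] D) {ℓ : Ω → ℝ≥0}
    (hℓ : Measurable[m1] ℓ) {F : E → Finset E} {κ : ℝ≥0}
    (h : ∀ (m k : ℕ) A, MeasurableSet[m1] A → A ⊆ D →
      μ (A ∩ {ω | Z (((k + 1 : ℕ) : ℝ≥0) / 2 ^ m) ω ∉ F (Z ((k : ℝ≥0) / 2 ^ m) ω)}) ≤
        κ * (1 / 2 ^ m) * μ A) :
    ∫⁻ ω in D, liminf (fun m => gridEscapes F (fun t => Z t ω) (ℓ ω) m) atTop ∂μ ≤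
      κ * ∫⁻ ω in D, ℓ ω ∂μ := by
  have hℓ0 : Measurable ℓ := hℓ.mono hm1 le_rfl
  refine (lintegral_liminf_le fun m => measurable_gridEscapes hZ hℓ0 F m).trans ?_
  have hb (m : ℕ) := setLIntegral_gridEscapes_le hm1 hZ hD hℓ (h m)
  refine (liminf_le_liminf (Eventually.of_forall hb)).trans (le_of_eq ?_)
  refine Tendsto.liminf_eq ?_
  refine ENNReal.Tendsto.const_mul ?_ (Or.inr ENNReal.coe_ne_top)
  simp_rw [lintegral_add_right _ measurable_const, lintegral_const]
  have h2 : Tendsto (fun m : ℕ => (1 / 2 : ℝ≥0∞) ^ m * μ.restrict D Set.univ) atTop (𝓝 0) := by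
    have := ENNReal.Tendsto.mul_const (b := μ.restrict D Set.univ)
      (ENNReal.tendsto_pow_atTop_nhds_zero_of_lt_one (r := 1 / 2) (by simp))
      (Or.inr (measure_ne_top _ _))
    simpa using this
  simpa [one_div, ENNReal.inv_pow] using h2.const_add (∫⁻ ω in D, ℓ ω ∂μ)

/-- Borel–Cantelli in integrated form: the expected counts are of order `2⁻ᵐ`, hence summable, and
counts tending to `0` vanish eventually. -/
theorem ae_eventually_gridEscapes_eq_zero [IsFiniteMeasure μ] (hm1 : m1 ≤ m0) {Z : ℝ≥0 → Ω → E}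
    (hZ : ∀ t, Measurable (Z t)) {D : Set Ω} (hD : MeasurableSet[m1] D) {ℓ : Ω → ℝ≥0}
    (hℓ : Measurable[m1] ℓ) {T : ℝ≥0} (hℓT : ∀ ω, ℓ ω ≤ T) {F : E → Finset E} {κ : ℝ≥0}
    (h : ∀ (m k : ℕ) A, MeasurableSet[m1] A → A ⊆ D →
      μ (A ∩ {ω | Z (((k + 1 : ℕ) : ℝ≥0) / 2 ^ m) ω ∉ F (Z ((k : ℝ≥0) / 2 ^ m) ω)}) ≤
        (κ / 2 ^ m : ℝ≥0) * (1 / 2 ^ m) * μ A) :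
    ∀ᵐ ω ∂μ, ω ∈ D → ∀ᶠ m in atTop, gridEscapes F (fun t => Z t ω) (ℓ ω) m = 0 := by
  have hℓ0 : Measurable ℓ := hℓ.mono hm1 le_rfl
  rw [← ae_restrict_iff' (hm1 _ hD)]
  have hmeas := fun m => measurable_gridEscapes hZ hℓ0 F m
  have hfin : ∫⁻ ω in D, ∑' m, gridEscapes F (fun t => Z t ω) (ℓ ω) m ∂μ ≠ ⊤ := by
    rw [lintegral_tsum fun m => (hmeas m).aemeasurable]
    have hb : ∀ m, ∫⁻ ω in D, gridEscapes F (fun t => Z t ω) (ℓ ω) m ∂μ ≤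
        (1 / 2) ^ m * (κ * ((T + 1) * μ D)) := by
      intro m
      refine (setLIntegral_gridEscapes_le hm1 hZ hD hℓ (h m)).trans ?_
      have : ∫⁻ ω in D, ((ℓ ω : ℝ≥0∞) + 1 / 2 ^ m) ∂μ ≤ ∫⁻ ω in D, ((T : ℝ≥0∞) + 1) ∂μ := by
        refine lintegral_mono fun ω => add_le_add (ENNReal.coe_le_coe.2 (hℓT ω)) ?_
        rw [one_div]
        exact ENNReal.inv_le_one.2 (one_le_pow₀ one_le_two)
      rw [setLIntegral_const] at this
      calc _ ≤ ((κ / 2 ^ m : ℝ≥0) : ℝ≥0∞) * ((T + 1) * μ D) := by gcongr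
        _ = _ := by
          rw [ENNReal.coe_div (by simp), div_eq_mul_inv, one_div, ← ENNReal.inv_pow]
          push_cast
          ring
    refine ne_top_of_le_ne_top ?_ (ENNReal.tsum_le_tsum hb)
    rw [ENNReal.tsum_mul_right, ENNReal.tsum_geometric]
    refine ENNReal.mul_ne_top ?_ (ENNReal.mul_ne_top ENNReal.coe_ne_top
      (ENNReal.mul_ne_top (by simp) (measure_ne_top _ _)))
    simp
  filter_upwards [ae_lt_top (Measurable.tsum hmeas) hfin] with ω hω
  filter_upwards [(ENNReal.tendsto_atTop_zero_of_tsum_ne_top hω.ne).eventually_lt_const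
    zero_lt_one] with m hm
  exact gridEscapes_eq_zero_of_lt_one hm

end Chain

/-! ### Paths glued together at the jump times. -/

section Path

/-- The time which a path spends in its `n`-th constancy interval before time `T`. -/
noncomputable def holdingTime {S : Type*} (f : ℝ≥0 → S) (T : ℝ≥0) (n : ℕ) : ℝ≥0 :=
  (min (jumpTime f (n + 1)) T - min (jumpTime f n) T).toNNReal

variable {S E : Type*} {f : ℝ≥0 → S} {z : ℕ → ℝ≥0 → E} {x : ℝ≥0 → E}

theorem coe_holdingTime (f : ℝ≥0 → S) (T : ℝ≥0) (n : ℕ) :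
    (holdingTime f T n : ℝ≥0∞) = min (jumpTime f (n + 1)) T - min (jumpTime f n) T :=
  ENNReal.coe_toNNReal (ne_top_of_le_ne_top ENNReal.coe_ne_top
    (tsub_le_self.trans (min_le_right _ (T : ℝ≥0∞))))

theorem holdingTime_le (f : ℝ≥0 → S) (T : ℝ≥0) (n : ℕ) : holdingTime f T n ≤ T := by
  rw [← ENNReal.coe_le_coe, coe_holdingTime]
  exact tsub_le_self.trans (min_le_right _ _)

theorem tsum_holdingTime_le (f : ℝ≥0 → S) (T : ℝ≥0) :
    ∑' n, (holdingTime f T n : ℝ≥0∞) ≤ T := by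
  have h (N : ℕ) : ∑ n ∈ Finset.range N, (holdingTime f T n : ℝ≥0∞) = min (jumpTime f N) T := by
    induction N with
    | zero => simp [jumpTime]
    | succ N ih =>
      rw [Finset.sum_range_succ, ih, coe_holdingTime]
      exact add_tsub_cancel_of_le (min_le_min_right _ (jumpTime_le_succ f N))
  rw [ENNReal.tsum_eq_iSup_nat]
  exact iSup_le fun N => (h N).trans_le (min_le_right _ _)

/-- A path assembled from right-constant pieces is right-constant. -/
theorem IsCadlagStep.isRightConstant_of_pieces (hf : IsCadlagStep f)
    (hz : ∀ n, IsRightConstant (z n))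
    (hx : ∀ n (t : ℝ≥0), jumpTime f n ≤ t → t < jumpTime f (n + 1) →
      x t = z n (t - (jumpTime f n).toNNReal)) : IsRightConstant x := by
  intro t
  obtain ⟨n, h1, h2⟩ := hf.exists_mem_Ico_jumpTime t
  have hγ : jumpTime f n ≠ ⊤ := (h1.trans_lt ENNReal.coe_lt_top).ne
  have h1' : (jumpTime f n).toNNReal ≤ t := by
    rwa [← ENNReal.coe_le_coe, ENNReal.coe_toNNReal hγ]
  have hev : ∀ᶠ s : ℝ≥0 in 𝓝[>] t, (s : ℝ≥0∞) < jumpTime f (n + 1) :=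
    ((ENNReal.continuous_coe.tendsto t).mono_left nhdsWithin_le_nhds).eventually_lt_const h2
  have htend : Tendsto (fun s => s - (jumpTime f n).toNNReal) (𝓝[>] t)
      (𝓝[>] (t - (jumpTime f n).toNNReal)) := by
    refine tendsto_nhdsWithin_iff.2 ⟨?_, ?_⟩
    · exact ((continuous_id.sub continuous_const).tendsto t).mono_left nhdsWithin_le_nhds
    · filter_upwards [self_mem_nhdsWithin] with s hs
      exact tsub_lt_tsub_right_of_le h1' hs
  filter_upwards [hev, htend.eventually (hz n _), self_mem_nhdsWithin] with s h3 h4 h5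
  rw [hx n s (h1.trans (ENNReal.coe_le_coe.2 (le_of_lt h5))) h3, h4, hx n t h1 h2]

theorem IsCadlagStep.eVariationOn_pieces_le {G : Type*} [PseudoEMetricSpace G]
    (hf : IsCadlagStep f)
    (hx : ∀ n (t : ℝ≥0), jumpTime f n ≤ t → t < jumpTime f (n + 1) →
      x t = z n (t - (jumpTime f n).toNNReal))
    (hglue : ∀ n, jumpTime f (n + 1) ≠ ⊤ →
      z (n + 1) 0 = z n (jumpTime f (n + 1) - jumpTime f n).toNNReal)
    (φ : E → G) (T : ℝ≥0) {v : ℕ → ℝ≥0∞}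
    (hv : ∀ n, jumpTime f n ≠ ⊤ →
      eVariationOn (fun t => φ (z n t)) (Set.Icc 0 (holdingTime f T n)) ≤ v n) :
    eVariationOn (fun t => φ (x t)) (Set.Icc 0 T) ≤ ∑' n, v n := by
  let g : ℕ → ℝ≥0 := fun n => (min (jumpTime f n) T).toNNReal
  have htop (n : ℕ) : min (jumpTime f n) T ≠ ⊤ :=
    ne_top_of_le_ne_top ENNReal.coe_ne_top (min_le_right _ (T : ℝ≥0∞))
  have hg : Monotone g := fun a b hab =>
    ENNReal.toNNReal_mono (htop b) (min_le_min_right _ (jumpTime_mono f hab))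
  obtain ⟨N, hN⟩ := hf.exists_lt_jumpTime T
  have hg0 : g 0 = 0 := by simp [g, jumpTime]
  have hgN : g N = T := by simp [g, min_eq_right hN.le]
  have hpiece (n : ℕ) : eVariationOn (fun t => φ (x t)) (Set.Icc (g n) (g (n + 1))) ≤ v n := by
    rcases lt_or_ge (T : ℝ≥0∞) (jumpTime f n) with h | h
    · have e1 : g n = T := by simp [g, min_eq_right h.le]
      have e2 : g (n + 1) = T := by
        simp [g, min_eq_right (h.le.trans (jumpTime_le_succ f n))]
      rw [e1, e2, Set.Icc_self, eVariationOn.subsingleton _ Set.subsingleton_singleton]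
      exact zero_le
    · have hγ : jumpTime f n ≠ ⊤ := (h.trans_lt ENNReal.coe_lt_top).ne
      have e1 : g n = (jumpTime f n).toNNReal := by simp only [g, min_eq_left h]
      have e2 : g (n + 1) - g n = holdingTime f T n := by
        rw [← ENNReal.coe_inj, coe_holdingTime, ENNReal.coe_sub, ENNReal.coe_toNNReal (htop n),
          ENNReal.coe_toNNReal (htop (n + 1))]
      refine le_trans ?_ (hv n hγ)
      have hEq : Set.EqOn (fun t => φ (x t)) ((fun t => φ (z n t)) ∘ fun t => t - g n)
          (Set.Icc (g n) (g (n + 1))) := by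
        intro t ht
        have ht1 : jumpTime f n ≤ t := by
          rw [← ENNReal.coe_toNNReal hγ, ← e1]
          exact ENNReal.coe_le_coe.2 ht.1
        have ht2 : (t : ℝ≥0∞) ≤ jumpTime f (n + 1) := by
          refine (ENNReal.coe_le_coe.2 ht.2).trans ?_
          rw [ENNReal.coe_toNNReal (htop (n + 1))]
          exact min_le_left _ _
        simp only [Function.comp_apply]
        congr 1
        rcases ht2.lt_or_eq with h3 | h3
        · rw [hx n t ht1 h3, e1]
        -- At the right endpoint `x` already follows the next piece, but gluing gives the same
        -- value, so switching contributes no variation.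
        · have h4 : jumpTime f (n + 1) ≠ ⊤ := h3 ▸ ENNReal.coe_ne_top
          have h5 : t = (jumpTime f (n + 1)).toNNReal := by rw [← h3]; simp
          rw [hx (n + 1) t h3.ge (h3 ▸ hf.1.jumpTime_lt_succ h4), h5, tsub_self, hglue n h4, e1,
            ENNReal.toNNReal_sub hγ]
      rw [eVariationOn.congr hEq]
      refine eVariationOn.comp_le_of_monotoneOn _ _ (fun a _ b _ hab => tsub_le_tsub_right hab _) ?_
      intro t ht
      refine ⟨zero_le, ?_⟩
      rw [← e2]
      exact tsub_le_tsub_right ht.2 _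
  have hsum := eVariationOn.sum' (fun t => φ (x t)) hg (n := N)
  rw [hg0, hgN] at hsum
  rw [← hsum]
  exact (Finset.sum_le_sum fun n _ => hpiece n).trans (ENNReal.sum_le_tsum _)

end Path

/-! ### The jump count of a switching process. -/

section Switching

variable {Ω S E : Type*} {mY m0 : MeasurableSpace Ω} {μ : Measure Ω}
  [MeasurableSpace S] [MeasurableSpace E]

theorem switchingHistory_le {Y : ℝ≥0 → Ω → S} (hY : ∀ t, Measurable (Y t))
    {Z : ℕ → ℝ≥0 → Ω → E} (hZ : ∀ n t, Measurable (Z n t)) (n : ℕ) (s : ℝ≥0) :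
    switchingHistory Y Z n s ≤ m0 :=
  sup_le (sup_le (iSup_le fun t => (hY t).comap_le)
    (iSup_le fun m => iSup_le fun _ => iSup_le fun t => (hZ m t).comap_le))
    (iSup_le fun u => iSup_le fun _ => (hZ n u).comap_le)

theorem measurable_switchingHistory (Y : ℝ≥0 → Ω → S) (Z : ℕ → ℝ≥0 → Ω → E) (n : ℕ) (s : ℝ≥0) :
    Measurable[switchingHistory Y Z n s] (Z n s) :=
  Measurable.mono (comap_measurable (Z n s)) (le_sup_of_le_right
    (le_iSup₂ (f := fun u (_ : u ≤ s) => MeasurableSpace.comap (Z n u) inferInstance) s le_rfl))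
    le_rfl

variable [IsProbabilityMeasure μ] [MeasurableSingletonClass S] [Countable S]
  [MeasurableSingletonClass E] [Countable E]

/-- A switching process with bounded rates, whose chains can only jump from `i` into `F i`, has
paths of bounded variation, and the number of its jumps up to time `T` has mean at most `C * T`. -/
theorem IsSwitchingProcess.exists_jumpCount_of_measurable {q : S → E → E → ℝ} {x₀ : E} {Y : ℝ≥0 → Ω → S}
    {X : ℝ≥0 → Ω → E} (hX : IsSwitchingProcess μ q x₀ Y X) (hY : ∀ t, Measurable (Y t))
    (hmY : mY ≤ m0) (hYm : ∀ t, Measurable[mY] (Y t))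
    (hhist : ∀ (Z : ℕ → ℝ≥0 → Ω → E) n s, mY ≤ switchingHistory Y Z n s)
    (hYp : ∀ ω, IsCadlagStep (fun t => Y t ω)) (hq : ∀ y, IsIntensityMatrix (q y)) {C : ℝ≥0}
    (hC : ∀ y i, exitRate (q y) i ≤ C) {F : E → Finset E} (hFi : ∀ i, i ∈ F i)
    (hF : ∀ y i, ∀ j ∉ F i, q y i j = 0) (T : ℝ≥0) :
    (∀ ω, IsRightConstant (fun t => X t ω)) ∧ (∀ ω, X 0 ω = x₀) ∧
    ∃ V : Ω → ℝ≥0∞, Measurable V ∧ ∫⁻ ω, V ω ∂μ ≤ C * T ∧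
      ∀ᵐ ω ∂μ, ∀ (φ : E → ℝ) (c : ℝ≥0), (∀ i, ∀ j ∈ F i, |φ i - φ j| ≤ c) →
        eVariationOn (fun t => φ (X t ω)) (Set.Icc 0 T) ≤ c * V ω := by
  obtain ⟨P, Z, hP, hZ, hZr, hZ0, hglue, hM, hXZ⟩ := hX
  let γ : ℕ → Ω → ℝ≥0∞ := fun n ω => jumpTime (fun t => Y t ω) n
  let ℓ : ℕ → Ω → ℝ≥0 := fun n ω => holdingTime (fun t => Y t ω) T n
  let D : ℕ → Set Ω := fun n => {ω | γ n ω ≠ ⊤}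
  have hγ (n : ℕ) : Measurable[mY] (γ n) := measurable_jumpTime hYm (fun ω => (hYp ω).1) n
  have hℓ (n : ℕ) : Measurable[mY] (ℓ n) := by
    refine Measurable.ennreal_toNNReal ?_
    exact ((hγ (n + 1)).min measurable_const).sub ((hγ n).min measurable_const)
  have hD (n : ℕ) : MeasurableSet[mY] (D n) := hγ n (measurableSet_singleton ⊤).compl
  have hmark (n : ℕ) (F' : E → Finset E) (m k : ℕ) (κ : ℝ≥0)
      (hκ : ∀ y i, 1 - ∑ j ∈ F' i, P y (1 / 2 ^ m) i j ≤ κ) (A : Set Ω)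
      (hA : MeasurableSet[mY] A) (hAD : A ⊆ D n) :
      μ (A ∩ {ω | Z n (((k + 1 : ℕ) : ℝ≥0) / 2 ^ m) ω ∉ F' (Z n ((k : ℝ≥0) / 2 ^ m) ω)}) ≤
        κ * μ A := by
    have e : ((k + 1 : ℕ) : ℝ≥0) / 2 ^ m = (k : ℝ≥0) / 2 ^ m + 1 / 2 ^ m := by
      push_cast; rw [add_div]
    rw [e]
    refine measure_inter_notMem_le (switchingHistory_le hY hZ n ((k : ℝ≥0) / 2 ^ m))
      (measurable_switchingHistory Y Z n _) (hZ n _) (D := D n)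
      (p := fun ω => P (Y (γ n ω).toNNReal ω) (1 / 2 ^ m)) (fun a => hM n _ _ a)
      (fun ω i => hκ _ i) ?_ hAD
    exact hhist Z n _ _ hA
  have hjump (n m k : ℕ) (A : Set Ω) (hA : MeasurableSet[mY] A) (hAD : A ⊆ D n) :
      μ (A ∩ {ω | Z n (((k + 1 : ℕ) : ℝ≥0) / 2 ^ m) ω ∉ ({Z n ((k : ℝ≥0) / 2 ^ m) ω} : Finset E)}) ≤
        C * (1 / 2 ^ m) * μ A := by
    refine (hmark n (fun i => {i}) m k (C * (1 / 2 ^ m)) (fun y i => ?_) A hA hAD).trans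
      (le_of_eq ?_)
    · rw [Finset.sum_singleton]
      refine ((hP y).one_sub_le (hq y) _ i).trans ?_
      rw [NNReal.coe_mul]
      exact mul_le_mul_of_nonneg_right (hC y i) (NNReal.coe_nonneg _)
    · rw [ENNReal.coe_mul, ENNReal.coe_div (by simp)]
      push_cast
      rfl
  have hbad (n m k : ℕ) (A : Set Ω) (hA : MeasurableSet[mY] A) (hAD : A ⊆ D n) :
      μ (A ∩ {ω | Z n (((k + 1 : ℕ) : ℝ≥0) / 2 ^ m) ω ∉ F (Z n ((k : ℝ≥0) / 2 ^ m) ω)}) ≤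
        (C ^ 2 / 2 ^ m : ℝ≥0) * (1 / 2 ^ m) * μ A := by
    refine (hmark n F m k (C ^ 2 / 2 ^ m * (1 / 2 ^ m)) (fun y i => ?_) A hA hAD).trans
      (le_of_eq ?_)
    · refine ((hP y).escape_le_sq (hq y) C.coe_nonneg (hC y) (hFi i) (hF y i) _).trans (le_of_eq ?_)
      push_cast
      ring
    · rw [ENNReal.coe_mul, ENNReal.coe_div (r := 2 ^ m) (p := 1) (by simp)]
      push_cast
      rfl
  -- Off `D n` the `n`-th chain is never used and its law is unspecified, so it must not be counted.
  let v : ℕ → Ω → ℝ≥0∞ := fun n => (D n).indicator fun ω =>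
    liminf (fun m => gridEscapes (fun i => {i}) (fun t => Z n t ω) (ℓ n ω) m) atTop
  have hv (n : ℕ) : Measurable (v n) := by
    refine Measurable.indicator ?_ (hmY _ (hD n))
    exact Measurable.liminf fun m =>
      measurable_gridEscapes (hZ n) ((hℓ n).mono hmY le_rfl) _ m
  refine ⟨fun ω => (hYp ω).isRightConstant_of_pieces (hZr · ω) (hXZ · ω), fun ω => ?_,
    fun ω => ∑' n, v n ω, Measurable.tsum hv, ?_, ?_⟩
  · have h := hXZ 0 ω 0 (by simp [jumpTime])
      (by simpa [jumpTime] using (hYp ω).1.jumpTime_lt_succ (n := 0) (by simp [jumpTime]))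
    rw [h, zero_tsub, hZ0]
  · change ∫⁻ ω, ∑' n, v n ω ∂μ ≤ C * T
    rw [lintegral_tsum fun n => (hv n).aemeasurable]
    calc ∑' n, ∫⁻ ω, v n ω ∂μ ≤ ∑' n, C * ∫⁻ ω, ℓ n ω ∂μ := by
          refine ENNReal.tsum_le_tsum fun n => ?_
          rw [lintegral_indicator (hmY _ (hD n))]
          refine (setLIntegral_liminf_gridEscapes_le hmY (hZ n) (hD n) (hℓ n) (hjump n)).trans ?_
          gcongr
          exact Measure.restrict_le_self
      _ = C * ∫⁻ ω, ∑' n, (ℓ n ω : ℝ≥0∞) ∂μ := by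
          rw [ENNReal.tsum_mul_left, lintegral_tsum]
          exact fun n => ((hℓ n).mono hmY le_rfl).coe_nnreal_ennreal.aemeasurable
      _ ≤ C * ∫⁻ _, (T : ℝ≥0∞) ∂μ := by
          gcongr with ω
          exact tsum_holdingTime_le _ T
      _ = C * T := by simp
  -- The null set is fixed before `φ` and `c`, which may then be chosen depending on `ω`.
  · have hae : ∀ᵐ ω ∂μ, ∀ n, ω ∈ D n →
        ∀ᶠ m in atTop, gridEscapes F (fun t => Z n t ω) (ℓ n ω) m = 0 :=
      ae_all_iff.2 fun n => ae_eventually_gridEscapes_eq_zero hmY (hZ n) (hD n) (hℓ n)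
        (fun ω => holdingTime_le _ T n) (hbad n)
    filter_upwards [hae] with ω hω φ c hφ
    rw [← ENNReal.tsum_mul_left]
    refine (hYp ω).eVariationOn_pieces_le (z := fun n t => Z n t ω) (hXZ · ω) (hglue · ω) φ T fun n hn => ?_
    refine ((hZr n ω).eVariationOn_le_liminf (ℓ n ω) (hω n hn) hφ).trans (le_of_eq ?_)
    rw [show v n ω = _ from Set.indicator_of_mem (show ω ∈ D n from hn) _]

theorem IsSwitchingProcess.exists_jumpCount {q : S → E → E → ℝ} {x₀ : E} {Y : ℝ≥0 → Ω → S}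
    {X : ℝ≥0 → Ω → E} (hX : IsSwitchingProcess μ q x₀ Y X) (hY : ∀ t, Measurable (Y t))
    (hYp : ∀ ω, IsCadlagStep (fun t => Y t ω)) (hq : ∀ y, IsIntensityMatrix (q y)) {C : ℝ≥0}
    (hC : ∀ y i, exitRate (q y) i ≤ C) {F : E → Finset E} (hFi : ∀ i, i ∈ F i)
    (hF : ∀ y i, ∀ j ∉ F i, q y i j = 0) (T : ℝ≥0) :
    (∀ ω, IsRightConstant (fun t => X t ω)) ∧ (∀ ω, X 0 ω = x₀) ∧
    ∃ V : Ω → ℝ≥0∞, Measurable V ∧ ∫⁻ ω, V ω ∂μ ≤ C * T ∧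
      ∀ᵐ ω ∂μ, ∀ (φ : E → ℝ) (c : ℝ≥0), (∀ i, ∀ j ∈ F i, |φ i - φ j| ≤ c) →
        eVariationOn (fun t => φ (X t ω)) (Set.Icc 0 T) ≤ c * V ω :=
  hX.exists_jumpCount_of_measurable (mY := ⨆ t, MeasurableSpace.comap (Y t) inferInstance) hY
    (iSup_le fun t => (hY t).comap_le)
    (fun t => Measurable.mono (comap_measurable (Y t))
      (le_iSup (fun t => MeasurableSpace.comap (Y t) _) t) le_rfl)
    (fun _ _ _ => le_sup_left.trans le_sup_left) hYp hq hC hFi hF T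

end Switching

/-! ### Summation by parts for integrals. -/

section IntegralBound

theorem sum_mul_sub_eq {a G : ℕ → ℝ} (hG : G 0 = 0) (n : ℕ) :
    ∑ k ∈ Finset.range n, a (k + 1) * (G (k + 1) - G k) =
      a n * G n - ∑ k ∈ Finset.range n, G k * (a (k + 1) - a k) := by
  induction n with
  | zero => simp [hG]
  | succ n ih => rw [Finset.sum_range_succ, Finset.sum_range_succ, ih]; ring

theorem abs_sum_mul_sub_le {a G : ℕ → ℝ} (hG : G 0 = 0) {n : ℕ} {η B W : ℝ} (hη : 0 ≤ η)
    (hGη : ∀ k ≤ n, |G k| ≤ η) (ha : |a n| ≤ B)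
    (hW : ∑ k ∈ Finset.range n, |a (k + 1) - a k| ≤ W) :
    |∑ k ∈ Finset.range n, a (k + 1) * (G (k + 1) - G k)| ≤ η * (B + W) := by
  rw [sum_mul_sub_eq hG]
  have h1 : |a n * G n| ≤ B * η := by
    rw [abs_mul]
    exact mul_le_mul ha (hGη n le_rfl) (abs_nonneg _) ((abs_nonneg _).trans ha)
  have h2 : |∑ k ∈ Finset.range n, G k * (a (k + 1) - a k)| ≤ η * W := by
    refine (Finset.abs_sum_le_sum_abs _ _).trans (le_trans ?_ (mul_le_mul_of_nonneg_left hW hη))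
    rw [Finset.mul_sum]
    refine Finset.sum_le_sum fun k hk => ?_
    rw [abs_mul]
    exact mul_le_mul_of_nonneg_right (hGη k (Finset.mem_range.1 hk).le) (abs_nonneg _)
  calc _ ≤ |a n * G n| + |∑ k ∈ Finset.range n, G k * (a (k + 1) - a k)| := abs_sub _ _
    _ ≤ η * (B + W) := by linarith

theorem measurable_roundUp (m : ℕ) : Measurable (roundUp m) :=
  (Measurable.of_discrete (f := fun k : ℕ => ((k + 1 : ℕ) : ℝ≥0) / 2 ^ m)).comp
    (Nat.measurable_floor.comp (measurable_id.mul_const _))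

/-- If a bounded function `g` has small primitive, then so has `f * g` for `f` of bounded
variation. -/
theorem IsRightConstant.abs_integral_mul_le {f : ℝ≥0 → ℝ} (hf : IsRightConstant f)
    (hfm : Measurable f) {B W : ℝ} (hB : ∀ t, |f t| ≤ B) (hW0 : 0 ≤ W) {r : ℝ≥0}
    (hW : eVariationOn f (Set.Icc 0 r) ≤ ENNReal.ofReal W) {g : ℝ → ℝ}
    (hg : IntervalIntegrable g volume 0 r) {η : ℝ}
    (hη : ∀ s ∈ Set.Icc (0 : ℝ) r, |∫ t in (0 : ℝ)..s, g t| ≤ η) :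
    |∫ t in (0 : ℝ)..r, f t.toNNReal * g t| ≤ η * (B + W) := by
  have hη0 : 0 ≤ η := (abs_nonneg _).trans (hη 0 ⟨le_rfl, r.2⟩)
  have hB0 : 0 ≤ B := (abs_nonneg _).trans (hB 0)
  rcases eq_or_ne r 0 with rfl | hr
  · simp; positivity
  have hr0 : (0 : ℝ) < r := by positivity
  -- `f` is sampled at the next point of a grid scaled by `r`, so that `r` itself is a grid point;
  -- right-constancy gives pointwise convergence.
  let F : ℕ → ℝ → ℝ := fun m t => f (r * roundUp m (t.toNNReal / r)) * g t
  have hlim : Tendsto (fun m => ∫ t in (0 : ℝ)..r, F m t) atTop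
      (𝓝 (∫ t in (0 : ℝ)..r, f t.toNNReal * g t)) := by
    refine intervalIntegral.tendsto_integral_filter_of_dominated_convergence
      (fun t => B * |g t|) ?_ ?_ ?_ ?_
    · refine Eventually.of_forall fun m => ?_
      refine AEStronglyMeasurable.mul ?_ hg.def'.aestronglyMeasurable
      exact (hfm.comp (((measurable_roundUp m).comp
        (measurable_real_toNNReal.div_const r)).const_mul r)).aestronglyMeasurable
    · refine Eventually.of_forall fun m => Eventually.of_forall fun t _ => ?_
      rw [Real.norm_eq_abs, abs_mul]
      exact mul_le_mul_of_nonneg_right (hB _) (abs_nonneg _)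
    · exact hg.abs.const_mul B
    · refine Eventually.of_forall fun t _ => Tendsto.mul_const _ ?_
      have h1 : Tendsto (fun m => r * roundUp m (t.toNNReal / r)) atTop (𝓝[>] t.toNNReal) := by
        have h2 := tendsto_nhdsWithin_iff.1 (tendsto_roundUp (t.toNNReal / r))
        refine tendsto_nhdsWithin_iff.2 ⟨?_, Eventually.of_forall fun m => ?_⟩
        · have := h2.1.const_mul r
          rwa [mul_div_cancel₀ _ hr] at this
        · have := mul_lt_mul_of_pos_left (lt_roundUp m (t.toNNReal / r)) (pos_iff_ne_zero.2 hr)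
          rwa [mul_div_cancel₀ _ hr] at this
      exact tendsto_const_nhds.congr' ((h1.eventually (hf _)).mono fun m h => h.symm)
  refine le_of_tendsto hlim.abs (Eventually.of_forall fun m => ?_)
  let u : ℕ → ℝ≥0 := fun k => r * (k / 2 ^ m)
  have hu : Monotone u := fun a b hab => by simp only [u]; gcongr
  have hun : u (2 ^ m) = r := by simp [u]
  have hu0 : u 0 = 0 := by simp [u]
  have hmem (k : ℕ) (hk : k ≤ 2 ^ m) : u k ∈ Set.Icc 0 r := ⟨zero_le, hun ▸ hu hk⟩
  have hgi (k : ℕ) (hk : k ≤ 2 ^ m) : IntervalIntegrable g volume 0 (u k) := by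
    refine hg.mono_set ?_
    rw [Set.uIcc_of_le (u k).coe_nonneg, Set.uIcc_of_le r.coe_nonneg]
    exact Set.Icc_subset_Icc le_rfl (hmem k hk).2
  have hpiece (k : ℕ) (hk : k < 2 ^ m) :
      ∀ᵐ t ∂volume, t ∈ Set.uIoc (u k : ℝ) (u (k + 1)) → F m t = f (u (k + 1)) * g t := by
    -- `roundUp` is strict, so the right endpoint belongs to the next cell and is discarded as a
    -- null set.
    filter_upwards [Measure.ae_ne volume (u (k + 1) : ℝ)] with t hne ht
    rw [Set.uIoc_of_le (NNReal.coe_le_coe.2 (hu k.le_succ))] at ht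
    have ht2 : t < u (k + 1) := lt_of_le_of_ne ht.2 hne
    have ht0 : 0 ≤ t := (u k).2.trans ht.1.le
    have hfl : ⌊t.toNNReal / r * 2 ^ m⌋₊ = k := by
      rw [Nat.floor_eq_iff zero_le]
      lift t to ℝ≥0 using ht0
      rw [Real.toNNReal_coe]
      have h1 : u k < t := NNReal.coe_lt_coe.1 ht.1
      have h2 : t < u (k + 1) := NNReal.coe_lt_coe.1 ht2
      have e : t / r * 2 ^ m = t * 2 ^ m / r := by rw [div_mul_eq_mul_div]
      have hrp : 0 < r := pos_iff_ne_zero.2 hr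
      simp only [u, mul_div_assoc'] at h1 h2
      rw [div_lt_iff₀ (by positivity)] at h1
      rw [lt_div_iff₀ (by positivity)] at h2
      rw [e, le_div_iff₀ hrp, div_lt_iff₀ hrp]
      refine ⟨by rw [mul_comm]; exact h1.le, by rw [mul_comm _ r]; exact_mod_cast h2⟩
    simp only [F, roundUp, hfl, u]
  have hsum : ∫ t in (0 : ℝ)..r, F m t = ∑ k ∈ Finset.range (2 ^ m),
      f (u (k + 1)) * ((∫ t in (0 : ℝ)..u (k + 1), g t) - ∫ t in (0 : ℝ)..u k, g t) := by
    have hadj := intervalIntegral.sum_integral_adjacent_intervals (f := F m) (μ := volume)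
      (a := fun k => (u k : ℝ)) (n := 2 ^ m) fun k hk => by
        refine ((((hgi k hk.le).symm.trans (hgi (k + 1) hk)).const_mul
          (f (u (k + 1)))).congr_ae ?_)
        rw [EventuallyEq, ae_restrict_iff' measurableSet_uIoc]
        filter_upwards [hpiece k hk] with t ht hmem using (ht hmem).symm
    rw [hu0, hun, NNReal.coe_zero] at hadj
    rw [← hadj]
    refine Finset.sum_congr rfl fun k hk => ?_
    have hk' := Finset.mem_range.1 hk
    rw [intervalIntegral.integral_congr_ae (hpiece k hk'), intervalIntegral.integral_const_mul,
      intervalIntegral.integral_interval_sub_left (hgi (k + 1) hk') (hgi k hk'.le)]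
  rw [hsum]
  refine abs_sum_mul_sub_le (a := fun k => f (u k)) (G := fun k => ∫ t in (0 : ℝ)..u k, g t)
    (by simp [hu0]) hη0 (fun k hk => hη _ ⟨(u k).2, (hmem k hk).2⟩) (hB _) ?_
  rw [← ENNReal.ofReal_le_ofReal_iff hW0]
  refine le_trans (le_of_eq ?_) ((eVariationOn.sum_le_of_monotoneOn_Iic (f := f) (u := u)
    (s := Set.Icc 0 r) (n := 2 ^ m) (hu.monotoneOn _) fun i hi => hmem i hi).trans hW)
  rw [ENNReal.ofReal_sum_of_nonneg fun _ _ => abs_nonneg _]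
  exact Finset.sum_congr rfl fun k _ => by rw [edist_dist, Real.dist_eq]

end IntegralBound

/-! ### Small primitives from ergodicity. -/

section Ergodic

theorem intervalIntegrable_of_abs_le {g : ℝ → ℝ} (hg : Measurable g) {b : ℝ}
    (hb : ∀ t, |g t| ≤ b) (s t : ℝ) : IntervalIntegrable g volume s t :=
  (intervalIntegrable_const (c := b)).mono_fun' hg.aestronglyMeasurable
    (Eventually.of_forall hb)

/-- If the primitive of `g` grows sublinearly along the integers, then the primitives of the
rescaled functions are uniformly small on compact intervals. -/
theorem abs_integral_comp_div_le {g : ℝ → ℝ} (hg : Measurable g) (hg1 : ∀ t, |g t| ≤ 1) {δ : ℝ}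
    (hδ : 0 ≤ δ) {k : ℕ} (hk : ∀ j ≥ k, |∫ t in (0 : ℝ)..(j : ℝ), g t| ≤ δ * j) {ε : ℝ}
    (hε : 0 < ε) {s T : ℝ} (hs : s ∈ Set.Icc 0 T) :
    |∫ t in (0 : ℝ)..s, g (t / ε)| ≤ δ * T + ε * (k + 1) := by
  rw [intervalIntegral.integral_comp_div _ hε.ne', zero_div, smul_eq_mul, abs_mul, abs_of_pos hε]
  have hgi := intervalIntegrable_of_abs_le hg hg1
  have hq : 0 ≤ s / ε := div_nonneg hs.1 hε.le
  -- The error `ε * (k + 1)` allows `k` for integer times up to `k` and `1` for the fractional part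
  -- of `s / ε`.
  set j := ⌊s / ε⌋₊
  have hj1 : (j : ℝ) ≤ s / ε := Nat.floor_le hq
  have hj2 : s / ε < j + 1 := Nat.lt_floor_add_one _
  have h1 : |∫ t in (j : ℝ)..(s / ε), g t| ≤ 1 := by
    have := intervalIntegral.norm_integral_le_of_norm_le_const (a := (j : ℝ)) (b := s / ε)
      (f := g) (C := 1) fun t _ => hg1 t
    rw [Real.norm_eq_abs, abs_of_nonneg (sub_nonneg.2 hj1)] at this
    linarith
  have h2 : |∫ t in (0 : ℝ)..(s / ε), g t| ≤ |∫ t in (0 : ℝ)..(j : ℝ), g t| + 1 := by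
    rw [← intervalIntegral.integral_add_adjacent_intervals (hgi 0 j) (hgi j (s / ε))]
    exact (abs_add_le _ _).trans (by linarith)
  have h3 : |∫ t in (0 : ℝ)..(j : ℝ), g t| ≤ δ * (s / ε) + k := by
    rcases le_total k j with h | h
    · have := mul_le_mul_of_nonneg_left hj1 hδ
      have hk0 : (0 : ℝ) ≤ k := k.cast_nonneg
      linarith [hk j h]
    · have := intervalIntegral.norm_integral_le_of_norm_le_const (a := (0 : ℝ)) (b := j)
        (f := g) (C := 1) fun t _ => hg1 t
      rw [Real.norm_eq_abs, sub_zero, abs_of_nonneg (Nat.cast_nonneg (α := ℝ) j)] at this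
      have hjk : (j : ℝ) ≤ k := by exact_mod_cast h
      have := mul_nonneg hδ hq
      linarith
  have h4 : ε * (δ * (s / ε)) = δ * s := by field_simp
  have h5 := mul_le_mul_of_nonneg_left (h2.trans (add_le_add_left h3 1)) hε.le
  have h6 := mul_le_mul_of_nonneg_left hs.2 hδ
  nlinarith

/-- By almost sure convergence the exceptional events decrease to a null set, so continuity from
above applies. Integer times keep each event a countable union. -/
theorem exists_measure_exists_lt_abs_le {Ω : Type*} {m0 : MeasurableSpace Ω} {μ : Measure Ω}
    [IsFiniteMeasure μ] {H : ℕ → Ω → ℝ} (hH : ∀ j, Measurable (H j))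
    (hlim : ∀ᵐ ω ∂μ, Tendsto (fun j : ℕ => 1 / (j : ℝ) * H j ω) atTop (𝓝 0)) {δ : ℝ}
    (hδ : 0 < δ) {ρ : ℝ≥0∞} (hρ : 0 < ρ) :
    ∃ k : ℕ, μ {ω | ∃ j ≥ k, δ * j < |H j ω|} < ρ := by
  let A : ℕ → Set Ω := fun k => {ω | ∃ j ≥ k, δ * j < |H j ω|}
  have hA (k : ℕ) : MeasurableSet (A k) := by
    have e : A k = ⋃ j, ⋃ _ : k ≤ j, {ω | δ * j < |H j ω|} := by ext ω; simp [A]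
    rw [e]
    exact .iUnion fun j => .iUnion fun _ => measurableSet_lt measurable_const (hH j).abs
  have hanti : Antitone A := fun a b hab ω ⟨j, hj, h⟩ => ⟨j, hab.trans hj, h⟩
  have hzero : μ (⋂ k, A k) = 0 := by
    refine measure_mono_null (fun ω hω => ?_) (ae_iff.1 hlim)
    intro hlim
    obtain ⟨N, hN⟩ := eventually_atTop.1 ((hlim.abs).eventually_lt_const (by simpa using hδ))
    obtain ⟨j, hj, h⟩ := Set.mem_iInter.1 hω (max N 1)
    have hj0 : (0 : ℝ) < j := by exact_mod_cast (le_max_right N 1).trans hj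
    have := hN j ((le_max_left N 1).trans hj)
    rw [abs_mul, abs_of_pos (by positivity), one_div, inv_mul_lt_iff₀ hj0] at this
    linarith
  have ht := tendsto_measure_iInter_atTop (μ := μ) (fun k => (hA k).nullMeasurableSet) hanti
    ⟨0, measure_ne_top _ _⟩
  rw [hzero] at ht
  exact (ht.eventually_lt_const hρ).exists

end Ergodic

/-! ### The deterministic estimate for a path with few jumps. -/

section PathIntegral

variable {I : Set ℝ}

/-- The points of `I` that can be reached from `i` by a step in `J ∪ {0}`. -/
noncomputable def neighbours (I : Set ℝ) (J : Finset ℝ) (i : I) : Finset I :=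
  (((insert (i : ℝ) (J.image fun a => (i : ℝ) + a)).finite_toSet).preimage
    (f := ((↑) : I → ℝ)) Subtype.val_injective.injOn).toFinset

theorem mem_neighbours {J : Finset ℝ} {i j : I} :
    j ∈ neighbours I J i ↔ j = i ∨ (j : ℝ) - i ∈ J := by
  simp only [neighbours, Set.Finite.mem_toFinset, Set.mem_preimage, Finset.mem_coe,
    Finset.mem_insert, Finset.mem_image, Subtype.ext_iff]
  refine or_congr_right ⟨?_, fun h => ⟨_, h, by ring⟩⟩
  rintro ⟨a, ha, h⟩
  rwa [← h, add_sub_cancel_left]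

theorem abs_sub_le_of_mem_neighbours {J : Finset ℝ} {i j : I} (h : j ∈ neighbours I J i) :
    |(i : ℝ) - j| ≤ (∑ a ∈ J, ‖a‖₊ : ℝ≥0) := by
  rcases mem_neighbours.1 h with rfl | h
  · rw [sub_self, abs_zero]
    exact NNReal.coe_nonneg _
  · rw [abs_sub_comm]
    exact_mod_cast Finset.single_le_sum (f := fun a : ℝ => ‖a‖₊) (fun _ _ => zero_le) h

variable {x : ℝ≥0 → I} {x₀ : I} {F : I → Finset I} {M v B T : ℝ≥0} {V : ℝ≥0∞}

theorem abs_le_of_eVariationOn_le (hx0 : x 0 = x₀)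
    (hvar : ∀ (φ : I → ℝ) (c : ℝ≥0), (∀ i, ∀ j ∈ F i, |φ i - φ j| ≤ c) →
      eVariationOn (fun t => φ (x t)) (Set.Icc 0 T) ≤ c * V) (hV : V ≤ v)
    (hM : ∀ i, ∀ j ∈ F i, |(i : ℝ) - j| ≤ M) {t : ℝ≥0} (ht : t ≤ T) :
    |(x t : ℝ)| ≤ |(x₀ : ℝ)| + M * v := by
  have h1 := (eVariationOn.edist_le (fun t => (x t : ℝ)) (s := Set.Icc 0 T) ⟨zero_le, ht⟩
    ⟨le_rfl, zero_le⟩).trans (hvar (fun i => (i : ℝ)) M hM)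
  have h2 : edist (x t : ℝ) (x 0 : ℝ) ≤ ((M * v : ℝ≥0) : ℝ≥0∞) := by
    refine h1.trans ?_
    rw [ENNReal.coe_mul]
    gcongr
  rw [edist_dist, Real.dist_eq, hx0] at h2
  have h3 : |(x t : ℝ) - x₀| ≤ (M * v : ℝ≥0) := by
    rwa [← ENNReal.ofReal_coe_nnreal, ENNReal.ofReal_le_ofReal_iff (NNReal.coe_nonneg _)] at h2
  rw [NNReal.coe_mul] at h3
  have := abs_add_le ((x t : ℝ) - x₀) x₀
  rw [sub_add_cancel] at this
  linarith

theorem integrableOn_and_abs_integral_le [Countable I] (hx : IsRightConstant x) (hx0 : x 0 = x₀)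
    (hvar : ∀ (φ : I → ℝ) (c : ℝ≥0), (∀ i, ∀ j ∈ F i, |φ i - φ j| ≤ c) →
      eVariationOn (fun t => φ (x t)) (Set.Icc 0 T) ≤ c * V) (hV : V ≤ v)
    (hM : ∀ i, ∀ j ∈ F i, |(i : ℝ) - j| ≤ M) {Q : I → ℝ}
    (hQ : ∀ i : I, |(i : ℝ)| ≤ |(x₀ : ℝ)| + M * v → |Q i| ≤ B) {g : ℝ → ℝ} (hg : Measurable g)
    (hg1 : ∀ t, |g t| ≤ 1) :
    IntegrableOn (fun t : ℝ => Q (x t.toNNReal) * g t) (Set.Icc 0 T) ∧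
    ∀ η : ℝ, (∀ s ∈ Set.Icc (0 : ℝ) T, |∫ t in (0 : ℝ)..s, g t| ≤ η) →
      ∀ r ∈ Set.Icc (0 : ℝ) T,
        |∫ t in (0 : ℝ)..r, Q (x t.toNNReal) * g t| ≤ η * (B + 2 * B * v) := by
  classical
  -- The path never leaves this ball before `T`, so cutting `Q` off outside changes nothing and
  -- makes it bounded; any two values of `φ` then differ by at most `2 * B`.
  let φ : I → ℝ := fun i => if |(i : ℝ)| ≤ |(x₀ : ℝ)| + M * v then Q i else 0
  have hφ (i : I) : |φ i| ≤ B := by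
    simp only [φ]
    split_ifs with h
    · exact hQ i h
    · simp
  have hφx (t : ℝ) (ht : t ∈ Set.Icc (0 : ℝ) T) : Q (x t.toNNReal) = φ (x t.toNNReal) :=
    (if_pos (abs_le_of_eVariationOn_le hx0 hvar hV hM (Real.toNNReal_le_iff_le_coe.2 ht.2))).symm
  have hmeas : Measurable fun t => φ (x t) :=
    (Measurable.of_discrete (f := φ)).comp hx.measurable
  refine ⟨?_, fun η hη r hr => ?_⟩
  · have h : IntegrableOn (fun t : ℝ => φ (x t.toNNReal) * g t) (Set.Icc 0 T) := by
      refine Measure.integrableOn_of_bounded (M := B) (by simp)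
        ((hmeas.comp measurable_real_toNNReal).mul hg).aestronglyMeasurable
        (Eventually.of_forall fun t => ?_)
      rw [Real.norm_eq_abs, abs_mul]
      exact (mul_le_mul (hφ _) (hg1 t) (abs_nonneg _) B.2).trans_eq (mul_one _)
    exact h.congr_fun (fun t ht => by simp only [hφx t ht]) measurableSet_Icc
  · lift r to ℝ≥0 using hr.1
    have hrT : r ≤ T := NNReal.coe_le_coe.1 hr.2
    have hcongr : ∫ t in (0 : ℝ)..r, Q (x t.toNNReal) * g t =
        ∫ t in (0 : ℝ)..r, φ (x t.toNNReal) * g t := by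
      refine intervalIntegral.integral_congr fun t ht => ?_
      rw [Set.uIcc_of_le r.coe_nonneg] at ht
      simp only [hφx t ⟨ht.1, ht.2.trans hr.2⟩]
    rw [hcongr]
    refine (hx.comp φ).abs_integral_mul_le hmeas (B := B) (W := 2 * B * v) (fun t => hφ _)
      (by positivity) ?_ (intervalIntegrable_of_abs_le hg hg1 _ _)
      fun s hs => hη s ⟨hs.1, hs.2.trans hr.2⟩
    refine (eVariationOn.mono _ (Set.Icc_subset_Icc le_rfl hrT)).trans
      ((hvar φ (2 * B) fun i j _ => ?_).trans ?_)
    · refine (abs_sub _ _).trans ?_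
      push_cast
      linarith [hφ i, hφ j]
    · calc ((2 * B : ℝ≥0) : ℝ≥0∞) * V ≤ (2 * B : ℝ≥0) * v := by gcongr
        _ = ENNReal.ofReal (2 * B * v) := by
          rw [← ENNReal.coe_mul, ← ENNReal.ofReal_coe_nnreal]; push_cast; rfl

end PathIntegral

/-! ### The averaging theorem. -/

theorem mainTheorem4
    {Ω : Type*} [MeasurableSpace Ω] (μ : Measure Ω) [IsProbabilityMeasure μ]
    -- the modulating process `Y`, with a finite state space
    {S : Type*} [Fintype S] [MeasurableSpace S] [MeasurableSingletonClass S]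
    (Y : ℝ≥0 → Ω → S) (hY_meas : ∀ t, Measurable (Y t))
    (hY_path : ∀ ω, IsCadlagStep (fun t => Y t ω))
    -- ergodicity of `Y`
    (π : S → ℝ) (hπ_nonneg : ∀ y, 0 ≤ π y) (hπ_sum : ∑ y, π y = 1)
    (hY_erg : ∀ y, ∀ᵐ ω ∂μ, Tendsto
      (fun t : ℝ => 1 / t * ∫ s in (0 : ℝ)..t,
        (Set.indicator {y} (fun _ => (1 : ℝ)) (Y s.toNNReal ω) - π y)) atTop (𝓝 0))
    -- the state space of `X` and the intensity matrices
    (I : Set ℝ) (hI : I.Countable)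
    (q : S → I → I → ℝ) (hq : ∀ y, IsIntensityMatrix (q y))
    (J : Finset ℝ) (hJ_zero : (0 : ℝ) ∉ J)
    (hqJ : ∀ y (i i' : I), i' ≠ i → (i' : ℝ) - (i : ℝ) ∉ J → q y i i' = 0)
    (hq_bdd : BddAbove (Set.range fun p : I × S => exitRate (q p.2) p.1))
    -- the switching processes `X ε` with modulating processes `t ↦ Y (t / ε)`
    (x₀ : I) (X : ℝ≥0 → ℝ≥0 → Ω → I)
    (hX : ∀ ε, 0 < ε → IsSwitchingProcess μ q x₀ (fun t => Y (t / ε)) (X ε))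
    -- the function `Q`
    (Q : I → S → ℝ)
    (hQ : ∀ y (K : ℝ), 0 < K → BddAbove ((fun i : I => |Q i y|) '' {i : I | |(i : ℝ)| ≤ K}))
    (y : S) (T : ℝ) (hT : 0 < T) :
    (∀ ε, 0 < ε → ∀ᵐ ω ∂μ, IntegrableOn
      (fun t : ℝ => Q (X ε t.toNNReal ω) y *
        (Set.indicator {y} (fun _ => (1 : ℝ)) (Y (t.toNNReal / ε) ω) - π y)) (Set.Icc 0 T)) ∧
    TendstoInMeasure μ
      (fun (ε : ℝ≥0) ω => ⨆ r : Set.Icc (0 : ℝ) T, |∫ t in (0 : ℝ)..r,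
        Q (X ε t.toNNReal ω) y *
          (Set.indicator {y} (fun _ => (1 : ℝ)) (Y (t.toNNReal / ε) ω) - π y)|)
      (𝓝[>] 0) (fun _ => 0) := by
  have : Countable I := hI.to_subtype
  obtain ⟨b, hb⟩ := hq_bdd
  let C : ℝ≥0 := b.toNNReal
  have hC (y : S) (i : I) : exitRate (q y) i ≤ C :=
    (hb ⟨(i, y), rfl⟩).trans (Real.le_coe_toNNReal b)
  let M : ℝ≥0 := ∑ a ∈ J, ‖a‖₊
  lift T to ℝ≥0 using hT.le
  have hT' : 0 < T := NNReal.coe_pos.1 hT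
  let g : Ω → ℝ → ℝ := fun ω s => Set.indicator {y} (fun _ => (1 : ℝ)) (Y s.toNNReal ω) - π y
  have hπ1 : π y ≤ 1 := hπ_sum ▸ Finset.single_le_sum (fun i _ => hπ_nonneg i) (Finset.mem_univ y)
  have hg1 (ω : Ω) (s : ℝ) : |g ω s| ≤ 1 := by
    have h0 := hπ_nonneg y
    by_cases h : Y s.toNNReal ω = y
    · simp only [g, Set.indicator_of_mem (Set.mem_singleton_iff.2 h)]
      rw [abs_le]; constructor <;> linarith
    · simp only [g, Set.indicator_of_notMem (fun h' => h (Set.mem_singleton_iff.1 h'))]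
      rw [abs_le]; constructor <;> linarith
  have hgm : Measurable fun p : Ω × ℝ => g p.1 p.2 := by
    refine Measurable.sub_const ?_ _
    refine (Measurable.of_discrete (f := Set.indicator {y} fun _ => (1 : ℝ))).comp ?_
    exact (measurable_uncurry_of_isRightConstant hY_meas fun ω => (hY_path ω).1).comp
      ((measurable_real_toNNReal.comp measurable_snd).prodMk measurable_fst)
  have hgω (ω : Ω) : Measurable (g ω) := hgm.comp measurable_prodMk_left
  have hgε (ε : ℝ≥0) (ω : Ω) (t : ℝ) :
      Set.indicator {y} (fun _ => (1 : ℝ)) (Y (t.toNNReal / ε) ω) - π y = g ω (t / ε) := by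
    simp only [g]
    rw [Real.toNNReal_div' ε.coe_nonneg, Real.toNNReal_coe]
  simp only [hgε]
  have hpath (ε : ℝ≥0) (hε : 0 < ε) := (hX ε hε).exists_jumpCount (fun t => hY_meas _)
    (fun ω => (hY_path ω).comp_div hε) hq hC (F := neighbours I J)
    (fun i => mem_neighbours.2 (Or.inl rfl))
    (fun y i j hj => hqJ y i j (fun h => hj (mem_neighbours.2 (Or.inl h)))
      (fun h => hj (mem_neighbours.2 (Or.inr h)))) T
  have hQB (v : ℝ≥0) : ∃ B : ℝ≥0, ∀ i : I, |(i : ℝ)| ≤ |(x₀ : ℝ)| + M * v → |Q i y| ≤ B := by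
    obtain ⟨c, hc⟩ := hQ y (|(x₀ : ℝ)| + M * v + 1) (by positivity)
    refine ⟨c.toNNReal, fun i hi => ?_⟩
    exact (hc ⟨i, hi.trans (by linarith), rfl⟩).trans (Real.le_coe_toNNReal c)
  have hgdiv (ε : ℝ≥0) (ω : Ω) : Measurable fun t : ℝ => g ω (t / ε) :=
    (hgω ω).comp (measurable_id.div_const _)
  refine ⟨fun ε hε => ?_, ?_⟩
  · obtain ⟨hXr, hX0, V, hVm, hVint, hV⟩ := hpath ε hε
    have hVfin := ae_lt_top hVm
      (hVint.trans_lt (ENNReal.mul_lt_top ENNReal.coe_lt_top ENNReal.coe_lt_top)).ne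
    filter_upwards [hV, hVfin] with ω hω hfin
    obtain ⟨B, hB⟩ := hQB (V ω).toNNReal
    exact (integrableOn_and_abs_integral_le (hXr ω) (hX0 ω) hω (ENNReal.coe_toNNReal hfin.ne).ge
      (fun i j hj => abs_sub_le_of_mem_neighbours hj) hB (hgdiv ε ω) (fun t => hg1 ω _)).1
  · refine tendstoInMeasure_of_ne_top fun a ha ha_top => ?_
    rw [ENNReal.tendsto_nhds_zero]
    intro ρ hρ
    obtain ⟨ρ', hρ'0, hρ'⟩ := ENNReal.lt_iff_exists_nnreal_btwn.1 hρ
    have hρ'pos : 0 < ρ' := ENNReal.coe_pos.1 hρ'0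
    lift a to ℝ≥0 using ha_top
    have ha0 : 0 < a := ENNReal.coe_pos.1 ha
    -- Chosen so that Markov's inequality gives `V ≥ v` probability at most `ρ' / 2`; the `+ 1`
    -- keeps `v` positive when `C = 0`.
    let v : ℝ≥0 := 2 * (C * T) / ρ' + 1
    have hv : C * T ≤ v * (ρ' / 2) := by
      have : 2 * (C * T) / ρ' * (ρ' / 2) = C * T := by field_simp
      rw [add_mul, this]
      exact le_self_add
    have hv0 : 0 < v := by positivity
    obtain ⟨B, hB⟩ := hQB v
    let L : ℝ := B + 2 * B * v + 1
    have hL : 0 < L := by positivity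
    -- With this `δ` the ergodic error contributes `δ * T * L = a / 4`; the rescaling error adds
    -- less than `a / 4` for small `ε`, giving a total below `a`.
    let δ : ℝ := a / (4 * T * L)
    have hδ : 0 < δ := by positivity
    -- This concerns the unscaled `Y` only, so `k` and the exceptional event serve all `ε` at once.
    obtain ⟨k, hk⟩ := exists_measure_exists_lt_abs_le (μ := μ)
      (H := fun j ω => ∫ t in (0 : ℝ)..(j : ℝ), g ω t)
      (fun j => by
        simp_rw [intervalIntegral.integral_of_le (Nat.cast_nonneg (α := ℝ) j)]
        exact (hgm.stronglyMeasurable.integral_prod_right' (ν := volume.restrict _)).measurable)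
      ((hY_erg y).mono fun ω h => h.comp tendsto_natCast_atTop_atTop) hδ
      (ρ := (ρ' / 2 : ℝ≥0)) (ENNReal.coe_pos.2 (by positivity))
    have hsmall : ∀ᶠ ε : ℝ≥0 in 𝓝[>] 0, (ε : ℝ) * (k + 1) * L < a / 4 := by
      have h : Tendsto (fun ε : ℝ≥0 => (ε : ℝ) * (k + 1) * L) (𝓝[>] 0) (𝓝 0) := by
        have h' : Continuous fun ε : ℝ≥0 => (ε : ℝ) * (k + 1) * L := by fun_prop
        simpa using (h'.tendsto 0).mono_left nhdsWithin_le_nhds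
      exact h.eventually_lt_const (by positivity)
    filter_upwards [hsmall, self_mem_nhdsWithin] with ε hε1 hε
    obtain ⟨hXr, hX0, V, hVm, hVint, hV⟩ := hpath ε hε
    have hVv : μ {ω | (v : ℝ≥0∞) ≤ V ω} ≤ (ρ' / 2 : ℝ≥0) := by
      have h := (mul_meas_ge_le_lintegral hVm v).trans hVint
      have h2 : (v : ℝ≥0∞) * μ {ω | (v : ℝ≥0∞) ≤ V ω} ≤ v * (ρ' / 2 : ℝ≥0) := by
        refine h.trans ?_
        rw [← ENNReal.coe_mul, ← ENNReal.coe_mul]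
        exact ENNReal.coe_le_coe.2 hv
      exact (ENNReal.mul_le_mul_iff_right (ENNReal.coe_pos.2 hv0).ne' ENNReal.coe_ne_top).1 h2
    refine le_trans (le_trans (measure_mono_ae ?_) (measure_union_le {ω | (v : ℝ≥0∞) ≤ V ω}
      {ω | ∃ j ≥ k, δ * j < |∫ t in (0 : ℝ)..(j : ℝ), g ω t|})) ?_
    · filter_upwards [hV] with ω hω hbig
      by_contra hnot
      obtain ⟨h1, h2⟩ := not_or.1 hnot
      have h1' : V ω ≤ v := (not_le.1 h1).le
      have h2' : ∀ j ≥ k, |∫ t in (0 : ℝ)..(j : ℝ), g ω t| ≤ δ * j := fun j hj =>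
        not_lt.1 fun h => h2 ⟨j, hj, h⟩
      have hη (s : ℝ) (hs : s ∈ Set.Icc (0 : ℝ) T) :
          |∫ t in (0 : ℝ)..s, g ω (t / ε)| ≤ δ * T + ε * (k + 1) :=
        abs_integral_comp_div_le (hgω ω) (hg1 ω) hδ.le h2' (NNReal.coe_pos.2 hε) hs
      have hbound := (integrableOn_and_abs_integral_le (hXr ω) (hX0 ω) hω h1'
        (fun i j hj => abs_sub_le_of_mem_neighbours hj) hB (hgdiv ε ω) (fun t => hg1 ω _)).2 _ hη
      have hsup : (⨆ r : Set.Icc (0 : ℝ) T, |∫ t in (0 : ℝ)..r,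
          Q (X ε t.toNNReal ω) y * g ω (t / ε)|) ≤ a / 2 := by
        have : Nonempty (Set.Icc (0 : ℝ) T) := ⟨⟨0, le_rfl, T.2⟩⟩
        refine ciSup_le fun r => (hbound r r.2).trans ?_
        have e1 : δ * T * L = a / 4 := by
          have hTne : (T : ℝ) ≠ 0 := hT.ne'
          simp only [δ]
          field_simp
        have hmono : (δ * T + ε * (k + 1)) * (B + 2 * B * v) ≤ (δ * T + ε * (k + 1)) * L := by
          have : (0 : ℝ) ≤ δ * T + ε * (k + 1) := by positivity
          exact mul_le_mul_of_nonneg_left (by simp [L]) this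
        linarith
      have hnn : 0 ≤ ⨆ r : Set.Icc (0 : ℝ) T, |∫ t in (0 : ℝ)..r,
          Q (X ε t.toNNReal ω) y * g ω (t / ε)| := Real.iSup_nonneg fun _ => abs_nonneg _
      have hbig' : (a : ℝ≥0∞) ≤ edist (⨆ r : Set.Icc (0 : ℝ) T, |∫ t in (0 : ℝ)..r,
          Q (X ε t.toNNReal ω) y * g ω (t / ε)|) 0 := hbig
      rw [edist_dist, Real.dist_eq, sub_zero, abs_of_nonneg hnn, ← ENNReal.ofReal_coe_nnreal,
        ENNReal.ofReal_le_ofReal_iff hnn] at hbig'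
      have : (0 : ℝ) < a := ha0
      linarith
    · refine (add_le_add hVv hk.le).trans ?_
      rw [← ENNReal.coe_add, add_halves]
      exact hρ'.le
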